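/- Let $n\ge 2$, $m\ge 1$ and $0<\alpha<1$. For $1\le i,j\le n$ let $a^{ij}\in C^{1,\alpha}_{\mathrm{loc}}(\mathbb{R}^n\times\mathbb{R}^m\times\mathbb{R}^{mn})$, and suppose that there is a $\lambda>0$ with $\sum_{i,j=1}^n a^{ij}(x,p,q)\,\xi_i\xi_j\ge\lambda|\xi|^2$ for all $(x,p,q)\in\mathbb{R}^n\times\mathbb{R}^m\times\mathbb{R}^{mn}$ and all $\xi\in\mathbb{R}^n$. For a $C^2$ map $\boldsymbol u=(u^1,\dots,u^m)$ from a subset of $\mathbb{R}^n$ to $\mathbb{R}^m$ put $L\boldsymbol u=(Lu^1,\dots,Lu^m)$ with $$Lu^k=\sum_{i,j=1}^n a^{ij}\big(x,\boldsymbol u(x),D\boldsymbol u(x)\big)\,D_{ij}u^k,\qquad 1\le k\le m.$$ Write $B_R=\{x\in\mathbb{R}^n: |x|\le R\}$ and $B'_{R'}=\{y\in\mathbb{R}^m:|y|\le R'\}$. Let $R_0,R'>0$ and let $\boldsymbol\phi:B_{R_0}\times B'_{R'}\times\mathbb{R}^{mn}\to\mathbb{R}^m$ be of class $C^{1,\alpha}_{\mathrm{loc}}$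 (that is, $C^1$ with first derivatives Hölder continuous with exponent $\alpha$ on compact subsets). Let $\boldsymbol{c_0}\in\mathbb{R}^m$ with $|\boldsymbol{c_0}|<R'$ and let $\boldsymbol{c_1}\in\mathbb{R}^{mn}$. Then there is an $R_1\in(0,R_0]$ such that for every $0<R\le R_1$ the system $$L\boldsymbol u(x)=\boldsymbol\phi\big(x,\boldsymbol u(x),D\boldsymbol u(x)\big)\ \text{ for } x\in B_R,\qquad \boldsymbol u(0)=\boldsymbol{c_0},\qquad D\boldsymbol u(0)=\boldsymbol{c_1},$$ has solutions $\boldsymbol u:B_R\to B'_{R'}$ of class $C^{2,\alpha}(B_R)$ (that is, $C^2$ on $B_R$ with second order partial derivatives Hölder continuous with exponent $\alpha$ on $B_R$), and in fact infinitely many. -/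

import Mathlib

open Set Metric
open scoped NNReal

noncomputable section

/-- `ℝ^d` with its Euclidean norm. -/
abbrev Euc (d : ℕ) : Type := EuclideanSpace ℝ (Fin d)

/-- The space of the variables `(x, p, q)` in `ℝ^n × ℝ^m × ℝ^{mn}`, where an `m × n` matrix `q`
is regarded as the linear map `ℝ^n → ℝ^m` that it represents. -/
abbrev Jet (n m : ℕ) : Type := Euc n × Euc m × (Euc n →L[ℝ] Euc m)

/-- `f` is of class `C^{1,α}_loc` on `s`: it is `C^1` on `s` and its first derivative is uniformly
Hölder continuous with exponent `α` on every compact subset of `s`. (It is used for closed convex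
sets `s` with nonempty interior, on which the derivative within `s` is unique.) -/
def IsC1HolderLoc {E F : Type*} [NormedAddCommGroup E] [NormedSpace ℝ E]
    [NormedAddCommGroup F] [NormedSpace ℝ F] (α : ℝ≥0) (s : Set E) (f : E → F) : Prop :=
  ContDiffOn ℝ 1 f s ∧
    ∀ K : Set E, K ⊆ s → IsCompact K → ∃ C : ℝ≥0, HolderOnWith C α (fderivWithin ℝ f s) K

/-- The partial derivative `D_i v` of a scalar function, taken within the set `s`. -/
def partialD {n : ℕ} (s : Set (Euc n)) (i : Fin n) (v : Euc n → ℝ) (x : Euc n) : ℝ :=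
  fderivWithin ℝ v s x (EuclideanSpace.single i 1)

/-- The second order partial derivative `D_{ij} v = D_i (D_j v)`, taken within the set `s`. -/
def partialD2 {n : ℕ} (s : Set (Euc n)) (i j : Fin n) (v : Euc n → ℝ) : Euc n → ℝ :=
  partialD s i (partialD s j v)

/-- `u` is of class `C^{2,α}` on the set `s`: it is `C^2` on `s` and all second order partial
derivatives of its components are Hölder continuous with exponent `α` on `s`. -/
def IsC2Holder {n m : ℕ} (α : ℝ≥0) (s : Set (Euc n)) (u : Euc n → Euc m) : Prop :=
  ContDiffOn ℝ 2 u s ∧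
    ∀ (k : Fin m) (i j : Fin n),
      ∃ C : ℝ≥0, HolderOnWith C α (partialD2 s i j (fun y => u y k)) s

/-- The quasilinear operator with coefficients `a^{ij}`, acting componentwise:
`(L u)^k = ∑ i j, a^{ij}(x, u(x), Du(x)) D_{ij} u^k(x)`, derivatives being taken within `s`. -/
def quasilinearOp {n m : ℕ} (a : Fin n → Fin n → Jet n m → ℝ) (s : Set (Euc n))
    (u : Euc n → Euc m) (x : Euc n) : Euc m :=
  WithLp.toLp 2 fun k : Fin m =>
    ∑ i : Fin n, ∑ j : Fin n,
      a i j (x, u x, fderivWithin ℝ u s x) * partialD2 s i j (fun y => u y k) x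

/-- The operator with coefficients `a^{ij}` is (uniformly) elliptic. -/
def IsElliptic {n m : ℕ} (a : Fin n → Fin n → Jet n m → ℝ) : Prop :=
  ∃ lam : ℝ, 0 < lam ∧ ∀ (z : Jet n m) (ξ : Euc n),
    lam * ‖ξ‖ ^ 2 ≤ ∑ i : Fin n, ∑ j : Fin n, a i j z * ξ i * ξ j

/-- `u` is a `C^{2,α}` solution, from the closed ball `B_R` of `ℝ^n` to the closed ball `B'_{R'}`
of `ℝ^m`, of the system `L u = φ(x, u, Du)`, `u(0) = c₀`, `Du(0) = c₁`. -/
structure IsSolution {n m : ℕ} (α : ℝ≥0) (a : Fin n → Fin n → Jet n m → ℝ) (φ : Jet n m → Euc m)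
    (c₀ : Euc m) (c₁ : Euc n →L[ℝ] Euc m) (R R' : ℝ) (u : Euc n → Euc m) : Prop where
  mapsTo : MapsTo u (closedBall 0 R) (closedBall 0 R')
  regular : IsC2Holder α (closedBall 0 R) u
  equation : ∀ x ∈ closedBall (0 : Euc n) R,
    quasilinearOp a (closedBall 0 R) u x = φ (x, u x, fderivWithin ℝ u (closedBall 0 R) x)
  value_zero : u 0 = c₀
  deriv_zero : fderivWithin ℝ u (closedBall 0 R) 0 = c₁

end

/-! Put `u(x) = c₀ + c₁ x + ρ² w(x/ρ)`. The initial conditions become `w(0) = 0`, `Dw(0) = 0`, the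
Hessian is unscaled, `D²u(x) = D²w(x/ρ)`, and the 1-jet of `u` over the ball of radius `ρ` stays
within `O(ρ)` of the base point `(0, c₀, c₁)`. So on the unit ball the system is a small
perturbation of `A : D²w = φ(0, c₀, c₁)` with the frozen matrix `A = a(0, c₀, c₁)`, and a
contraction in a Hölder norm solves it once `A : D²` has a bounded right inverse with small error.

That inverse is built without a fundamental solution. `exists_elliptic_kernel` supplies a compactly
supported `η` and an averaging kernel `ω` of mass one such that `A : D²η` generates the dilations of
`ω`. Writing `η_s = s⁻ⁿ η(·/s)`, the operator `P f = -∫₀^S s (η_s * f) ds` satisfies `A : D²(P f) =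
-∫₀^S d/ds (ω_s * f) ds = f - ω_S * f`, and the error has Lipschitz constant `O(1/S)`
(`exists_approx_right_inverse`). The Schauder type bound for `D²(P f)` is
`exists_holderBounded_integral_inv_smul_scaledConv`. Subtracting a quadratic polynomial makes `P f`
vanish to first order at `0` and the error vanish at `0`, hence small in the Hölder norm of the unit
ball (`exists_normalized_right_inverse`).

Infinitely many solutions come from the kernel of `A : D²`: since `n ≥ 2`, there are quadratic `h`
with `A : D²h = 0` and any prescribed pure second derivative `p` (`exists_quadratic_kernel`). With
`w = P f + h` and `P` normalized so as not to affect this derivative at `0`, the system becomes a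
fixed point problem for `f` (`exists_rescaled_solution`), and `p` can be read off from the solution
at the origin. -/

open MeasureTheory Filter Topology

/-! ### Convolution with dilated kernels -/

section ScaledConvolution

variable {n : ℕ} {G F H : Type*} [NormedAddCommGroup G] [NormedSpace ℝ G]
  [NormedAddCommGroup F] [NormedSpace ℝ F] [NormedAddCommGroup H] [NormedSpace ℝ H]

/-- The convolution of `f` with the dilation at scale `s` of the kernel `ψ`. -/
noncomputable def scaledConv (L : G →L[ℝ] F →L[ℝ] H) (ψ : Euc n → G) (f : Euc n → F) (s : ℝ)
    (x : Euc n) : H :=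
  ∫ z, L (ψ z) (f (x - s • z))

variable (L : G →L[ℝ] F →L[ℝ] H) {ψ : Euc n → G} {f : Euc n → F} {M s : ℝ}

/-- The substitution `t = s z` moves the scale into the kernel, so that derivatives in `x` and in
`s` fall on the kernel and `f` need only be continuous. The defining form, in contrast, still makes
sense at `s = 0`. -/
theorem scaledConv_eq_integral_dilation (hs : 0 < s) (x : Euc n) :
    scaledConv L ψ f s x = ∫ t, L ((s ^ n)⁻¹ • ψ (s⁻¹ • t)) (f (x - t)) := by
  have h := Measure.integral_comp_inv_smul_of_nonneg (volume : Measure (Euc n))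
    (fun z => L (ψ z) (f (x - s • z))) hs.le
  simp only [finrank_euclideanSpace, Fintype.card_fin, smul_inv_smul₀ hs.ne'] at h
  have hsn : s ^ n ≠ 0 := (pow_pos hs n).ne'
  simp only [map_smul, smul_apply, integral_smul, h, smul_smul,
    inv_mul_cancel₀ hsn, one_smul, scaledConv]

theorem integrable_scaledConv_integrand (hψ : Continuous ψ) (hψc : HasCompactSupport ψ)
    (hf : Continuous f) (s : ℝ) (x : Euc n) :
    Integrable fun z => L (ψ z) (f (x - s • z)) := by
  refine Continuous.integrable_of_hasCompactSupport (by fun_prop) ?_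
  refine hψc.mono fun z hz => ?_
  contrapose! hz
  simp only [Function.mem_support, not_not] at hz
  simp [hz]

/-- The constant in the sup norm estimate of `scaledConv`. -/
noncomputable def kernelMass (L : G →L[ℝ] F →L[ℝ] H) (ψ : Euc n → G) : ℝ :=
  ‖L‖ * ∫ z, ‖ψ z‖

theorem kernelMass_nonneg (ψ : Euc n → G) : 0 ≤ kernelMass L ψ :=
  mul_nonneg L.opNorm_nonneg (integral_nonneg fun z => by positivity)

theorem norm_scaledConv_le (hψ : Continuous ψ) (hψc : HasCompactSupport ψ)
    (hM : ∀ x, ‖f x‖ ≤ M) (s : ℝ) (x : Euc n) :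
    ‖scaledConv L ψ f s x‖ ≤ kernelMass L ψ * M := by
  have hi : Integrable fun z => ‖ψ z‖ := (hψ.integrable_of_hasCompactSupport hψc).norm
  calc ‖scaledConv L ψ f s x‖ ≤ ∫ z, (‖L‖ * M) * ‖ψ z‖ := by
        refine norm_integral_le_of_norm_le (hi.const_mul _) (Eventually.of_forall fun z => ?_)
        calc _ ≤ ‖L‖ * ‖ψ z‖ * ‖f (x - s • z)‖ := L.le_opNorm₂ _ _
          _ ≤ ‖L‖ * ‖ψ z‖ * M := by gcongr; exact hM _
          _ = _ := by ring
    _ = _ := by rw [integral_const_mul, kernelMass]; ring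

theorem hasFDerivAt_scaledConv (hψ : ContDiff ℝ 1 ψ) (hψc : HasCompactSupport ψ)
    (hf : Continuous f) (hs : 0 < s) (x : Euc n) :
    HasFDerivAt (scaledConv L ψ f s)
      (s⁻¹ • scaledConv (L.precompL (Euc n)) (fderiv ℝ ψ) f s x) x := by
  set k : Euc n → G := fun t => (s ^ n)⁻¹ • ψ (s⁻¹ • t) with hk
  have hkc : HasCompactSupport k := by
    have : HasCompactSupport fun t : Euc n => ψ (s⁻¹ • t) :=
      hψc.comp_smul (inv_ne_zero hs.ne')
    exact this.smul_left (f := fun _ => (s ^ n)⁻¹)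
  have hkd : ContDiff ℝ 1 k := by
    refine contDiff_const.smul (hψ.comp (contDiff_const_smul _))
  have h := hkc.hasFDerivAt_convolution_left (μ := volume) L hkd hf.locallyIntegrable x
  have h1 : scaledConv L ψ f s = (convolution k f L volume) :=
    funext fun y => scaledConv_eq_integral_dilation L hs y
  rw [h1]
  refine h.congr_fderiv ?_
  rw [scaledConv_eq_integral_dilation _ hs, convolution, ← integral_smul]
  congr 1
  ext1 t
  have : fderiv ℝ k t = s⁻¹ • (s ^ n)⁻¹ • fderiv ℝ ψ (s⁻¹ • t) := by
    have h2 : HasFDerivAt k ((s ^ n)⁻¹ • (fderiv ℝ ψ (s⁻¹ • t)).comp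
        (s⁻¹ • ContinuousLinearMap.id ℝ (Euc n))) t :=
      (((hψ.differentiable one_ne_zero _).hasFDerivAt (x := s⁻¹ • t)).comp t
        ((hasFDerivAt_id t).const_smul s⁻¹)).const_smul _
    rw [h2.fderiv]
    rw [ContinuousLinearMap.comp_smul, ContinuousLinearMap.comp_id, smul_comm]
  rw [this]
  simp

/-- Convolving `ψ` with the constant `1` gives a constant function, whose derivative is this
integral. -/
theorem integral_fderiv_eq_zero (hψ : ContDiff ℝ 1 ψ) (hψc : HasCompactSupport ψ) :
    ∫ z, fderiv ℝ ψ z = 0 := by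
  have h := hasFDerivAt_scaledConv (ContinuousLinearMap.lsmul ℝ ℝ (E := G)).flip hψ hψc
    (f := fun _ => (1 : ℝ)) continuous_const one_pos 0
  have h0 := h.unique (hasFDerivAt_const (∫ z, ψ z) (0 : Euc n) |>.congr_of_eventuallyEq
    (Eventually.of_forall fun x => by simp [scaledConv]))
  rw [inv_one, one_smul, scaledConv] at h0
  rw [← h0]
  congr 1
  ext z v
  simp

/-- Continuity includes `s = 0`, where the fundamental theorem of calculus in the scale is later
evaluated. -/
theorem continuous_scaledConv_scale (hψ : Continuous ψ) (hψc : HasCompactSupport ψ)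
    (hf : Continuous f) (hM : ∀ x, ‖f x‖ ≤ M) (x : Euc n) :
    Continuous fun s => scaledConv L ψ f s x := by
  have hi : Integrable fun z => ‖ψ z‖ := (hψ.integrable_of_hasCompactSupport hψc).norm
  refine continuous_of_dominated (bound := fun z => (‖L‖ * M) * ‖ψ z‖)
    (fun s => (integrable_scaledConv_integrand L hψ hψc hf s x).aestronglyMeasurable)
    (fun s => Eventually.of_forall fun z => ?_) (hi.const_mul _)
    (Eventually.of_forall fun z => by fun_prop)
  calc _ ≤ ‖L‖ * ‖ψ z‖ * ‖f (x - s • z)‖ := L.le_opNorm₂ _ _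
    _ ≤ ‖L‖ * ‖ψ z‖ * M := by gcongr; exact hM _
    _ = _ := by ring

/-- The constant in the estimate of `scaledConv` for kernels of mean zero. -/
noncomputable def kernelConst (L : G →L[ℝ] F →L[ℝ] H) (ψ : Euc n → G) (α : ℝ) : ℝ :=
  ‖L‖ * ∫ z, ‖ψ z‖ * ‖z‖ ^ α

theorem kernelConst_nonneg (ψ : Euc n → G) (α : ℝ) : 0 ≤ kernelConst L ψ α :=
  mul_nonneg L.opNorm_nonneg (integral_nonneg fun z => by positivity)

/-- Mean zero allows `f (x - s z)` to be replaced by its increment from `f x`, which is at most `M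
s^α ‖z‖^α`. The gain `s^α` is what makes `ds / s` integrable at `0`. -/
theorem norm_scaledConv_le_of_integral_eq_zero [CompleteSpace G] [CompleteSpace H]
    {α : ℝ} (hα : 0 ≤ α) (hψ : Continuous ψ)
    (hψc : HasCompactSupport ψ) (hψ0 : ∫ z, ψ z = 0) (hf : Continuous f)
    (hM : ∀ x y, ‖f x - f y‖ ≤ M * ‖x - y‖ ^ α) (hs : 0 ≤ s) (x : Euc n) :
    ‖scaledConv L ψ f s x‖ ≤ kernelConst L ψ α * M * s ^ α := by
  have hψi := hψ.integrable_of_hasCompactSupport hψc (μ := volume)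
  have h0 : ∫ z, L (ψ z) (f x) = 0 := by
    have := (L.flip (f x)).integral_comp_comm hψi
    simp only [ContinuousLinearMap.flip_apply] at this
    rw [this, hψ0, map_zero, zero_apply]
  have hi : Integrable fun z => ‖ψ z‖ * ‖z‖ ^ α := by
    refine Continuous.integrable_of_hasCompactSupport ?_ hψc.norm.mul_right
    exact hψ.norm.mul (continuous_norm.rpow_const fun _ => Or.inr hα)
  have h1 : scaledConv L ψ f s x = ∫ z, L (ψ z) (f (x - s • z) - f x) := by
    have h2 : Integrable fun z => L (ψ z) (f x) := (L.flip (f x)).integrable_comp hψi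
    simp only [map_sub]
    rw [integral_sub (integrable_scaledConv_integrand L hψ hψc hf s x) h2, h0, sub_zero,
      scaledConv]
  rw [h1]
  calc _ ≤ ∫ z, (‖L‖ * M * s ^ α) * (‖ψ z‖ * ‖z‖ ^ α) := by
        refine norm_integral_le_of_norm_le (hi.const_mul _) (Eventually.of_forall fun z => ?_)
        have h2 := hM (x - s • z) x
        rw [sub_sub_cancel_left, norm_neg, norm_smul, Real.norm_of_nonneg hs,
          Real.mul_rpow hs (norm_nonneg _)] at h2
        calc _ ≤ ‖L‖ * ‖ψ z‖ * ‖f (x - s • z) - f x‖ := L.le_opNorm₂ _ _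
          _ ≤ ‖L‖ * ‖ψ z‖ * (M * (s ^ α * ‖z‖ ^ α)) := by gcongr
          _ = _ := by ring
    _ = _ := by rw [integral_const_mul, kernelConst]; ring

/-- The generator of the dilations acting on the kernel `φ`: minus the divergence of `z ↦ φ(z) z`. -/
noncomputable def dilationGenerator (φ : Euc n → ℝ) (z : Euc n) : ℝ :=
  -(n * φ z + fderiv ℝ φ z z)

theorem continuous_dilationGenerator {φ : Euc n → ℝ} (hφ : ContDiff ℝ 1 φ) :
    Continuous (dilationGenerator φ) := by
  have := hφ.continuous
  have := (hφ.continuous_fderiv one_ne_zero).clm_apply continuous_id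
  unfold dilationGenerator
  simp only [id] at this
  fun_prop

theorem hasCompactSupport_dilationGenerator {φ : Euc n → ℝ} (hφc : HasCompactSupport φ) :
    HasCompactSupport (dilationGenerator φ) := by
  refine (hφc.mono' ?_ : HasCompactSupport (dilationGenerator φ))
  intro z hz
  by_contra h
  apply hz
  have h1 : φ z = 0 := image_eq_zero_of_notMem_tsupport h
  have h2 : fderiv ℝ φ z = 0 :=
    image_eq_zero_of_notMem_tsupport fun h' => h (tsupport_fderiv_subset ℝ h')
  simp [dilationGenerator, h1, h2]

theorem hasDerivAt_dilation {φ : Euc n → ℝ} (hφ : ContDiff ℝ 1 φ) (hs : 0 < s) (t : Euc n) :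
    HasDerivAt (fun r : ℝ => (r ^ n)⁻¹ * φ (r⁻¹ • t))
      (s⁻¹ * ((s ^ n)⁻¹ * dilationGenerator φ (s⁻¹ • t))) s := by
  have h1 : HasDerivAt (fun r : ℝ => r⁻¹ • t) (-(s ^ 2)⁻¹ • t) s :=
    (hasDerivAt_inv hs.ne').smul_const t
  have h2 : HasDerivAt (fun r : ℝ => φ (r⁻¹ • t)) (fderiv ℝ φ (s⁻¹ • t) (-(s ^ 2)⁻¹ • t)) s :=
    ((hφ.differentiable one_ne_zero _).hasFDerivAt (x := s⁻¹ • t)).comp_hasDerivAt s h1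
  have h3 : HasDerivAt (fun r : ℝ => (r ^ n)⁻¹) (-(n * s ^ (n - 1)) / (s ^ n) ^ 2) s :=
    (hasDerivAt_pow n s).inv (pow_pos hs n).ne'
  refine (h3.mul h2).congr_deriv ?_
  -- The exponent `n - 1` is truncated, so `n = 0` is treated separately.
  have h4 : (n : ℝ) * s ^ (n - 1) = n * s ^ n * s⁻¹ := by
    rcases n with _ | k
    · simp
    · simp only [Nat.add_sub_cancel, pow_succ]; field_simp
  have hsn : s ^ n ≠ 0 := (pow_pos hs n).ne'
  rw [h4]
  simp only [dilationGenerator, map_smul, smul_eq_mul]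
  field_simp
  ring

theorem hasDerivAt_scaledConv_scale {φ : Euc n → ℝ} (hφ : ContDiff ℝ 1 φ)
    (hφc : HasCompactSupport φ) (hf : Continuous f) (hM : ∀ x, ‖f x‖ ≤ M) (hs : 0 < s)
    (x : Euc n) :
    HasDerivAt (fun r => scaledConv (ContinuousLinearMap.lsmul ℝ ℝ) φ f r x)
      (s⁻¹ • scaledConv (ContinuousLinearMap.lsmul ℝ ℝ) (dilationGenerator φ) f s x) s := by
  have hχ := continuous_dilationGenerator hφ
  have hχc := hasCompactSupport_dilationGenerator hφc
  obtain ⟨C, hC⟩ := hχ.bounded_above_of_compact_support hχc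
  obtain ⟨R, hR⟩ := hχc.isCompact.isBounded.subset_closedBall 0
  have hC0 : 0 ≤ C := (norm_nonneg _).trans (hC 0)
  have hM0 : 0 ≤ M := (norm_nonneg _).trans (hM 0)
  -- For scales `r` within `s / 2` of `s`, one has `s / 2 ≤ r ≤ 2 s`: the lower bound controls the
  -- negative powers of `r`, the upper one confines the support to the ball of radius `2 s R`.
  set B : ℝ := (s / 2)⁻¹ * (((s / 2) ^ n)⁻¹ * C) * M with hB
  have key := hasDerivAt_integral_of_dominated_loc_of_deriv_le (μ := (volume : Measure (Euc n)))
    (F := fun r t => ((r ^ n)⁻¹ * φ (r⁻¹ • t)) • f (x - t))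
    (F' := fun r t => (r⁻¹ * ((r ^ n)⁻¹ * dilationGenerator φ (r⁻¹ • t))) • f (x - t))
    (s := ball s (s / 2)) (x₀ := s)
    (bound := (closedBall (0 : Euc n) (2 * s * R)).indicator fun _ => B)
    (ball_mem_nhds s (half_pos hs)) ?_ ?_ ?_ ?_ ?_ ?_
  · refine (key.2.congr_of_eventuallyEq ?_).congr_deriv ?_
    · filter_upwards [lt_mem_nhds hs] with r hr
      rw [scaledConv_eq_integral_dilation _ hr]
      simp
    · rw [scaledConv_eq_integral_dilation _ hs, ← integral_smul]
      simp [smul_smul]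
  · refine Eventually.of_forall fun r => Continuous.aestronglyMeasurable ?_
    have := hφ.continuous
    fun_prop
  · refine Continuous.integrable_of_hasCompactSupport (by have := hφ.continuous; fun_prop) ?_
    have : HasCompactSupport fun t : Euc n => φ (s⁻¹ • t) := hφc.comp_smul (inv_ne_zero hs.ne')
    exact (this.mul_left (f := fun _ => (s ^ n)⁻¹)).smul_right
  · exact Continuous.aestronglyMeasurable (by fun_prop)
  · refine Eventually.of_forall fun t r hr => ?_
    rw [Real.ball_eq_Ioo] at hr
    have hr1 : s / 2 ≤ r := by linarith [hr.1]
    have hr2 : r ≤ 2 * s := by linarith [hr.2]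
    have hr0 : 0 < r := by linarith [half_pos hs]
    by_cases ht : t ∈ closedBall (0 : Euc n) (2 * s * R)
    · rw [indicator_of_mem ht, norm_smul, norm_mul, norm_mul, norm_inv, norm_inv, norm_pow,
        Real.norm_of_nonneg hr0.le]
      have hs2 : 0 < s / 2 := half_pos hs
      rw [hB]
      gcongr
      · exact hC _
      · exact hM _
    · rw [indicator_of_notMem ht]
      have : dilationGenerator φ (r⁻¹ • t) = 0 := by
        refine image_eq_zero_of_notMem_tsupport fun h => ht ?_
        have h1 := hR h
        rw [mem_closedBall_zero_iff, norm_smul, norm_inv, Real.norm_of_nonneg hr0.le,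
          inv_mul_le_iff₀ hr0] at h1
        rw [mem_closedBall_zero_iff]
        have hR0 : 0 ≤ R := by
          by_contra hneg
          have := mul_neg_of_pos_of_neg hr0 (not_le.1 hneg)
          linarith [norm_nonneg t]
        exact h1.trans (by gcongr)
      simp [this]
  · refine (integrable_indicator_iff isClosed_closedBall.measurableSet).2 ?_
    exact integrableOn_const (isCompact_closedBall _ _).measure_lt_top.ne
  · refine Eventually.of_forall fun t r hr => ?_
    rw [Real.ball_eq_Ioo] at hr
    exact (hasDerivAt_dilation hφ (by linarith [hr.1, half_pos hs]) t).smul_const _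

end ScaledConvolution

/-! ### Hölder bounds -/

section Hoelder

variable {E F G H : Type*} [NormedAddCommGroup E] [NormedAddCommGroup F] [NormedAddCommGroup G]
  [NormedAddCommGroup H] {α M N : ℝ} {s t : Set E} {f g : E → F}

/-- `f` is bounded by `M` on `s` and Hölder continuous there with exponent `α` and constant `M`. -/
def HolderBounded (α : ℝ) (s : Set E) (M : ℝ) (f : E → F) : Prop :=
  (∀ x ∈ s, ‖f x‖ ≤ M) ∧ ∀ x ∈ s, ∀ y ∈ s, ‖f x - f y‖ ≤ M * ‖x - y‖ ^ α

theorem HolderBounded.mono (h : HolderBounded α s M f) (hMN : M ≤ N) (hts : t ⊆ s) :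
    HolderBounded α t N f :=
  ⟨fun x hx => (h.1 x (hts hx)).trans hMN, fun x hx y hy =>
    (h.2 x (hts hx) y (hts hy)).trans (by gcongr)⟩

theorem HolderBounded.congr (h : HolderBounded α s M f) (hfg : ∀ x ∈ s, g x = f x) :
    HolderBounded α s M g :=
  ⟨fun x hx => by rw [hfg x hx]; exact h.1 x hx,
    fun x hx y hy => by rw [hfg x hx, hfg y hy]; exact h.2 x hx y hy⟩

theorem HolderBounded.add (hf : HolderBounded α s M f) (hg : HolderBounded α s N g) :
    HolderBounded α s (M + N) fun x => f x + g x := by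
  refine ⟨fun x hx => (norm_add_le _ _).trans (add_le_add (hf.1 x hx) (hg.1 x hx)),
    fun x hx y hy => ?_⟩
  rw [add_sub_add_comm, add_mul]
  exact (norm_add_le _ _).trans (add_le_add (hf.2 x hx y hy) (hg.2 x hx y hy))

theorem HolderBounded.neg (hf : HolderBounded α s M f) :
    HolderBounded α s M fun x => -f x := by
  refine ⟨fun x hx => by rw [norm_neg]; exact hf.1 x hx, fun x hx y hy => ?_⟩
  rw [neg_sub_neg, norm_sub_rev]
  exact hf.2 x hx y hy

theorem HolderBounded.sub (hf : HolderBounded α s M f) (hg : HolderBounded α s N g) :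
    HolderBounded α s (M + N) fun x => f x - g x := by
  simpa only [sub_eq_add_neg] using hf.add hg.neg

theorem HolderBounded.continuous (hα : 0 < α) (hf : HolderBounded α univ M f) : Continuous f := by
  refine continuous_iff_continuousAt.2 fun x => ?_
  rw [ContinuousAt, tendsto_iff_norm_sub_tendsto_zero]
  have h : Tendsto (fun y => M * ‖y - x‖ ^ α) (𝓝 x) (𝓝 (M * ‖x - x‖ ^ α)) := by
    refine Continuous.tendsto (continuous_const.mul ?_) x
    exact (continuous_id.sub continuous_const).norm.rpow_const fun _ => Or.inr hα.le
  rw [sub_self, norm_zero, Real.zero_rpow hα.ne', mul_zero] at h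
  exact squeeze_zero (fun _ => norm_nonneg _) (fun y => hf.2 y (mem_univ _) x (mem_univ _)) h

theorem HolderBounded.nonneg (hf : HolderBounded α s M f) {x : E} (hx : x ∈ s) : 0 ≤ M :=
  (norm_nonneg _).trans (hf.1 x hx)

end Hoelder

/-! ### Singular integrals over the scale and their Hölder estimate -/

section Potential

variable {n : ℕ} {G F H : Type*} [NormedAddCommGroup G] [NormedSpace ℝ G]
  [NormedAddCommGroup F] [NormedSpace ℝ F] [NormedAddCommGroup H] [NormedSpace ℝ H]

theorem norm_integral_le_of_rpow_sub_one_bound {K : ℝ → H} {A α S : ℝ} (hα : 0 < α)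
    (hS : 0 ≤ S) (hA : ∀ s ∈ Ioc 0 S, ‖K s‖ ≤ A * s ^ (α - 1)) :
    ‖∫ s in 0..S, K s‖ ≤ A / α * S ^ α := by
  calc _ ≤ ∫ s in 0..S, A * s ^ (α - 1) :=
        intervalIntegral.norm_integral_le_of_norm_le hS
          (Eventually.of_forall fun s hs => hA s hs)
          ((intervalIntegral.intervalIntegrable_rpow' (by linarith)).const_mul A)
    _ = _ := by
        rw [intervalIntegral.integral_const_mul, integral_rpow (Or.inl (by linarith))]
        simp only [sub_add_cancel, Real.zero_rpow hα.ne', sub_zero]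
        ring

/-- Split the integral at `s = r`: the first bound is integrable at `0` because `α > 0`, the second
at infinity because `α < 1`, so the constant does not depend on `S`. It is applied with `r = ‖x -
y‖`. -/
theorem norm_integral_le_of_two_rpow_bounds {K : ℝ → H} {A B α r S : ℝ} (hα : 0 < α) (hα1 : α < 1)
    (hr : 0 < r) (hS : 0 < S) (hA0 : 0 ≤ A) (hB0 : 0 ≤ B) (hK : IntervalIntegrable K volume 0 S)
    (hA : ∀ s, 0 < s → ‖K s‖ ≤ A * s ^ (α - 1)) (hB : ∀ s, 0 < s → ‖K s‖ ≤ B * r * s ^ (α - 2)) :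
    ‖∫ s in 0..S, K s‖ ≤ (A / α + B / (1 - α)) * r ^ α := by
  have h1α : 0 < 1 - α := by linarith
  have hB' : 0 ≤ B / (1 - α) * r ^ α := by positivity
  rcases le_total S r with h | h
  · refine (norm_integral_le_of_rpow_sub_one_bound hα hS.le fun s hs => hA s hs.1).trans ?_
    have : A / α * S ^ α ≤ A / α * r ^ α := by gcongr
    rw [add_mul]; linarith
  · have hm : r ∈ uIcc 0 S := by rw [uIcc_of_le hS.le]; exact ⟨hr.le, h⟩
    rw [← intervalIntegral.integral_add_adjacent_intervals
      (hK.mono_set (uIcc_subset_uIcc_left hm)) (hK.mono_set (uIcc_subset_uIcc_right hm)), add_mul]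
    refine (norm_add_le _ _).trans (add_le_add
      (norm_integral_le_of_rpow_sub_one_bound hα hr.le fun s hs => hA s hs.1) ?_)
    have hni : (0 : ℝ) ∉ uIcc r S := by
      rw [uIcc_of_le h]; exact fun h0 => absurd h0.1 (not_le.2 hr)
    calc _ ≤ ∫ s in r..S, B * r * s ^ (α - 2) :=
          intervalIntegral.norm_integral_le_of_norm_le h
            (Eventually.of_forall fun s hs => hB s (hr.trans hs.1))
            ((intervalIntegral.intervalIntegrable_rpow (Or.inr hni)).const_mul _)
      _ = B / (1 - α) * (r * (r ^ (α - 1) - S ^ (α - 1))) := by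
          rw [intervalIntegral.integral_const_mul, integral_rpow (Or.inr ⟨by linarith, hni⟩)]
          have e : α - 2 + 1 = α - 1 := by ring
          have : α - 1 ≠ 0 := by linarith
          rw [e]; field_simp; ring
      _ ≤ B / (1 - α) * r ^ α := by
          have : r ^ α = r * r ^ (α - 1) := by
            rw [← Real.rpow_one_add' hr.le (by linarith)]; congr 1; ring
          rw [this]
          have : 0 ≤ S ^ (α - 1) := Real.rpow_nonneg hS.le _
          gcongr
          linarith

theorem norm_scaledConv_sub_le (L : G →L[ℝ] F →L[ℝ] H) {ψ : Euc n → G} {f : Euc n → F}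
    (hψ : ContDiff ℝ 1 ψ) (hψc : HasCompactSupport ψ)
    (hf : Continuous f) {c s : ℝ} (hs : 0 < s)
    (hc : ∀ x, ‖scaledConv (L.precompL (Euc n)) (fderiv ℝ ψ) f s x‖ ≤ c) (x y : Euc n) :
    ‖scaledConv L ψ f s x - scaledConv L ψ f s y‖ ≤ s⁻¹ * c * ‖x - y‖ := by
  refine convex_univ.norm_image_sub_le_of_norm_hasFDerivWithin_le
    (fun z _ => (hasFDerivAt_scaledConv L hψ hψc hf hs z).hasFDerivWithinAt) (fun z _ => ?_)
    (mem_univ y) (mem_univ x)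
  rw [norm_smul, norm_inv, Real.norm_of_nonneg hs.le]
  have := inv_nonneg.2 hs.le
  gcongr
  exact hc z

variable [CompleteSpace G] [CompleteSpace H]
variable (L : G →L[ℝ] F →L[ℝ] H) {ψ : Euc n → G} {f : Euc n → F} {M α S : ℝ}

theorem intervalIntegrable_inv_smul_scaledConv (hα : 0 < α) {w : ℝ → ℝ} {c : ℝ} (hw : Continuous w)
    (hwc : ∀ s ∈ Ioc 0 S, |w s| ≤ c) (hψ : Continuous ψ) (hψc : HasCompactSupport ψ)
    (hψ0 : ∫ z, ψ z = 0) (hf : HolderBounded α univ M f) (hS : 0 ≤ S) (x : Euc n) :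
    IntervalIntegrable (fun s => (w s * s⁻¹) • scaledConv L ψ f s x) volume 0 S := by
  have hfc := hf.continuous hα
  refine ((intervalIntegral.intervalIntegrable_rpow' (r := α - 1) (by linarith)).const_mul
    (c * (kernelConst L ψ α * M))).mono_fun' ?_ ?_
  · exact (hw.measurable.mul measurable_inv).aestronglyMeasurable.smul
      (continuous_scaledConv_scale L hψ hψc hfc (fun x => hf.1 x (mem_univ _)) x).aestronglyMeasurable
  · rw [uIoc_of_le hS]
    filter_upwards [ae_restrict_mem measurableSet_Ioc] with s hs
    have h1 := norm_scaledConv_le_of_integral_eq_zero L hα.le hψ hψc hψ0 hfc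
      (fun x y => hf.2 x (mem_univ _) y (mem_univ _)) hs.1.le x
    rw [norm_smul, norm_mul, norm_inv, Real.norm_of_nonneg hs.1.le, Real.norm_eq_abs,
      Real.rpow_sub_one hs.1.ne']
    have hc := hwc s hs
    have hc0 := (abs_nonneg _).trans hc
    have hs0 : 0 ≤ s⁻¹ := inv_nonneg.2 hs.1.le
    calc _ ≤ c * s⁻¹ * (kernelConst L ψ α * M * s ^ α) := by gcongr
      _ = _ := by ring

/-- Each derivative costs a factor `s⁻¹`, but the differentiated kernel has mean zero, so the
integrand is dominated by a multiple of `s^(α - 1)`. The weights `w s = s` and `w s = 1` serve the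
first and the second derivative of the potential. -/
theorem hasFDerivAt_integral_scaledConv (hα : 0 < α) {w : ℝ → ℝ} {c : ℝ} (hw : Continuous w)
    (hwc : ∀ s ∈ Ioc 0 S, |w s| ≤ c) (hψ : ContDiff ℝ 1 ψ) (hψc : HasCompactSupport ψ)
    (hf : HolderBounded α univ M f) (hS : 0 ≤ S) (x : Euc n) :
    HasFDerivAt (fun x => ∫ s in 0..S, w s • scaledConv L ψ f s x)
      (∫ s in 0..S, (w s * s⁻¹) • scaledConv (L.precompL (Euc n)) (fderiv ℝ ψ) f s x) x := by
  have hfc := hf.continuous hα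
  have hM : ∀ x, ‖f x‖ ≤ M := fun x => hf.1 x (mem_univ _)
  have hdc := hψ.continuous_fderiv one_ne_zero
  have hdk := hψc.fderiv (𝕜 := ℝ)
  have hd0 := integral_fderiv_eq_zero hψ hψc
  have hcont (x : Euc n) := hw.smul (continuous_scaledConv_scale L hψ.continuous hψc hfc hM x)
  refine intervalIntegral.hasFDerivAt_integral_of_dominated_of_fderiv_le (s := univ)
    (bound := fun s => c * (kernelConst (L.precompL (Euc n)) (fderiv ℝ ψ) α * M) *
      s ^ (α - 1)) (F' := fun x s => (w s * s⁻¹) • scaledConv (L.precompL (Euc n)) (fderiv ℝ ψ) f s x)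
      univ_mem
    (Eventually.of_forall fun x => (hcont x).aestronglyMeasurable)
    ((hcont x).intervalIntegrable _ _) ?_ (Eventually.of_forall fun s hs y _ => ?_)
    ((intervalIntegral.intervalIntegrable_rpow' (by linarith)).const_mul _)
    (Eventually.of_forall fun s hs y _ => ?_)
  · rw [uIoc_of_le hS]
    have := (intervalIntegrable_inv_smul_scaledConv (L.precompL (Euc n)) hα hw hwc hdc hdk hd0 hf
      hS x).aestronglyMeasurable
    exact this
  · rw [uIoc_of_le hS] at hs
    have h1 := norm_scaledConv_le_of_integral_eq_zero (L.precompL (Euc n)) hα.le hdc hdk hd0 hfc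
      (fun x y => hf.2 x (mem_univ _) y (mem_univ _)) hs.1.le y
    rw [norm_smul, norm_mul, norm_inv, Real.norm_of_nonneg hs.1.le, Real.norm_eq_abs,
      Real.rpow_sub_one hs.1.ne']
    have hc := hwc s hs
    have hc0 := (abs_nonneg _).trans hc
    have hs0 : 0 ≤ s⁻¹ := inv_nonneg.2 hs.1.le
    calc _ ≤ c * s⁻¹ * (kernelConst (L.precompL (Euc n)) (fderiv ℝ ψ) α * M * s ^ α) := by
          gcongr
      _ = _ := by ring
  · rw [uIoc_of_le hS] at hs
    have := (hasFDerivAt_scaledConv L hψ hψc hfc hs.1 y).const_smul (w s)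
    rwa [smul_smul] at this

/-- The Hölder estimate for the singular integral with a smooth kernel of mean zero. -/
theorem exists_holderBounded_integral_inv_smul_scaledConv (hα : 0 < α) (hα1 : α < 1)
    (hψ : ContDiff ℝ 1 ψ) (hψc : HasCompactSupport ψ) (hψ0 : ∫ z, ψ z = 0) (hS : 0 < S) :
    ∃ C, 0 ≤ C ∧ ∀ (f : Euc n → F) (M : ℝ), HolderBounded α univ M f →
      HolderBounded α univ (C * M) fun x => ∫ s in 0..S, s⁻¹ • scaledConv L ψ f s x := by
  set A := kernelConst L ψ α
  set B := kernelConst (L.precompL (Euc n)) (fderiv ℝ ψ) α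
  have hA0 : 0 ≤ A := kernelConst_nonneg _ _ _
  have hB0 : 0 ≤ B := kernelConst_nonneg _ _ _
  have h1α : 0 < 1 - α := by linarith
  refine ⟨max (A / α * S ^ α) (2 * A / α + B / (1 - α)), le_max_of_le_left (by positivity),
    fun f M hf => ?_⟩
  have hM0 : 0 ≤ M := hf.nonneg (mem_univ 0)
  have hfc := hf.continuous hα
  have hA1 : ∀ (x : Euc n) (s : ℝ), 0 < s → ‖s⁻¹ • scaledConv L ψ f s x‖ ≤ A * M * s ^ (α - 1) := by
    intro x s hs
    have h1 := norm_scaledConv_le_of_integral_eq_zero L hα.le hψ.continuous hψc hψ0 hfc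
      (fun x y => hf.2 x (mem_univ _) y (mem_univ _)) hs.le x
    rw [norm_smul, norm_inv, Real.norm_of_nonneg hs.le, Real.rpow_sub_one hs.ne']
    have hs0 : 0 ≤ s⁻¹ := inv_nonneg.2 hs.le
    calc _ ≤ s⁻¹ * (A * M * s ^ α) := by gcongr
      _ = _ := by ring
  have hii (x : Euc n) : IntervalIntegrable (fun s => s⁻¹ • scaledConv L ψ f s x) volume 0 S := by
    simpa using intervalIntegrable_inv_smul_scaledConv L hα (w := fun _ => 1) (c := 1)
      continuous_const (fun s _ => by simp) hψ.continuous hψc hψ0 hf hS.le x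
  refine ⟨fun x _ => ?_, fun x _ y _ => ?_⟩
  · refine (norm_integral_le_of_rpow_sub_one_bound hα hS.le fun s hs => hA1 x s hs.1).trans ?_
    calc _ = A / α * S ^ α * M := by ring
      _ ≤ _ := by gcongr; exact le_max_left _ _
  · rcases eq_or_ne x y with rfl | hxy
    · simp [Real.zero_rpow hα.ne']
    have hr : 0 < ‖x - y‖ := norm_pos_iff.2 (sub_ne_zero.2 hxy)
    rw [← intervalIntegral.integral_sub (hii x) (hii y)]
    -- The first constant comes from the triangle inequality, the second from the mean value theorem
    -- and the cancellation in `fderiv ℝ ψ`.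
    refine (norm_integral_le_of_two_rpow_bounds (A := 2 * A * M) (B := B * M) hα hα1 hr hS
      (by positivity) (by positivity) ((hii x).sub (hii y)) (fun s hs => ?_) fun s hs => ?_).trans ?_
    · calc _ ≤ A * M * s ^ (α - 1) + A * M * s ^ (α - 1) :=
            (norm_sub_le _ _).trans (add_le_add (hA1 x s hs) (hA1 y s hs))
        _ = _ := by ring
    · have h1 := norm_scaledConv_sub_le L hψ hψc hfc hs
        (norm_scaledConv_le_of_integral_eq_zero (L.precompL (Euc n)) hα.le
          (hψ.continuous_fderiv one_ne_zero) (hψc.fderiv (𝕜 := ℝ))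
          (integral_fderiv_eq_zero hψ hψc) hfc
          (fun x y => hf.2 x (mem_univ _) y (mem_univ _)) hs.le) x y
      have e : α - 2 = α - 1 - 1 := by ring
      rw [← smul_sub, norm_smul, norm_inv, Real.norm_of_nonneg hs.le, e, Real.rpow_sub_one hs.ne',
        Real.rpow_sub_one hs.ne']
      have hs0 : 0 ≤ s⁻¹ := inv_nonneg.2 hs.le
      calc _ ≤ s⁻¹ * (s⁻¹ * (B * M * s ^ α) * ‖x - y‖) := by gcongr
        _ = _ := by ring
    · calc _ = (2 * A / α + B / (1 - α)) * M * ‖x - y‖ ^ α := by ring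
        _ ≤ _ := by gcongr; exact le_max_right _ _

end Potential

/-! ### A kernel adapted to an elliptic matrix -/

section EllipticKernel

variable {n : ℕ}

theorem euc_inner_single_right (v : Euc n) (i : Fin n) :
    inner ℝ v (EuclideanSpace.single i (1 : ℝ)) = v i := by
  rw [real_inner_comm, EuclideanSpace.inner_single_left]; simp

/-- The quadratic form inverse to the symmetric part of an elliptic coefficient matrix. -/
theorem exists_inverse_form (A : Fin n → Fin n → ℝ) {lam : ℝ} (hlam : 0 < lam)
    (hA : ∀ ξ : Euc n, lam * ‖ξ‖ ^ 2 ≤ ∑ i, ∑ j, A i j * ξ i * ξ j) :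
    ∃ (b : Euc n →L[ℝ] Euc n →L[ℝ] ℝ) (c : ℝ), 0 < c ∧ (∀ v w, b v w = b w v) ∧
      (∀ z, c * ‖z‖ ^ 2 ≤ b z z) ∧
      (∀ z, ∑ i, ∑ j, A i j * (b z (EuclideanSpace.single i 1) * b z (EuclideanSpace.single j 1))
        = b z z) ∧
      ∑ i, ∑ j, A i j * b (EuclideanSpace.single i 1) (EuclideanSpace.single j 1) = n := by
  -- Ellipticity only sees the symmetric part of `A`, which is injective; `b` is the form of its
  -- inverse `B`. The last claim is then the trace of the identity, the antisymmetric part of `A`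
  -- dropping out against the symmetric `b`.
  let a : Euc n →ₗ[ℝ] Euc n :=
    { toFun := fun v => WithLp.toLp 2 fun i => ∑ j, (A i j + A j i) / 2 * v j
      map_add' := fun v w => by
        ext i; simp [mul_add, Finset.sum_add_distrib]
      map_smul' := fun r v => by
        ext i; simp only [PiLp.smul_apply, smul_eq_mul, RingHom.id_apply, Finset.mul_sum]
        exact Finset.sum_congr rfl fun j _ => by ring }
  have hin : ∀ v w : Euc n, inner ℝ (a v) w = ∑ i, ∑ j, (A i j + A j i) / 2 * v j * w i := by
    intro v w
    simp only [PiLp.inner_apply, a, LinearMap.coe_mk, AddHom.coe_mk, RCLike.inner_apply,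
      conj_trivial, Finset.mul_sum]
    exact Finset.sum_congr rfl fun i _ => Finset.sum_congr rfl fun j _ => by ring
  have hsymm : ∀ v w : Euc n, inner ℝ (a v) w = inner ℝ v (a w) := by
    intro v w
    rw [real_inner_comm (a w) v, hin, hin, Finset.sum_comm]
    exact Finset.sum_congr rfl fun i _ => Finset.sum_congr rfl fun j _ => by ring
  have hq : ∀ v : Euc n, inner ℝ (a v) v = ∑ i, ∑ j, A i j * v i * v j := by
    intro v
    have h1 : ∑ i, ∑ j, A j i * v j * v i = ∑ i, ∑ j, A i j * v i * v j := Finset.sum_comm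
    have h2 : inner ℝ (a v) v
        = (∑ i, ∑ j, A i j * v i * v j) / 2 + (∑ i, ∑ j, A j i * v j * v i) / 2 := by
      rw [hin, Finset.sum_div, Finset.sum_div, ← Finset.sum_add_distrib]
      refine Finset.sum_congr rfl fun i _ => ?_
      rw [Finset.sum_div, Finset.sum_div, ← Finset.sum_add_distrib]
      exact Finset.sum_congr rfl fun j _ => by ring
    rw [h2, h1]; ring
  have hinj : Function.Injective a := by
    rw [injective_iff_map_eq_zero]
    intro v hv
    have h := hA v
    rw [← hq, hv, inner_zero_left] at h
    have : ‖v‖ ^ 2 ≤ 0 := by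
      by_contra hneg
      have := mul_pos hlam (not_le.1 hneg)
      linarith
    exact norm_eq_zero.1 (pow_eq_zero_iff two_ne_zero |>.1 (le_antisymm this (sq_nonneg _)))
  let e : Euc n ≃ₗ[ℝ] Euc n := LinearEquiv.ofInjectiveEndo a hinj
  have he : ∀ v, a (e.symm v) = v := fun v => e.apply_symm_apply v
  let B : Euc n →L[ℝ] Euc n := LinearMap.toContinuousLinearMap e.symm.toLinearMap
  have hB : ∀ v, a (B v) = v := he
  let b : Euc n →L[ℝ] Euc n →L[ℝ] ℝ := (innerSL ℝ).comp B
  have hb : ∀ v w, b v w = inner ℝ (B v) w := fun v w => rfl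
  let aL : Euc n →L[ℝ] Euc n := LinearMap.toContinuousLinearMap a
  have hbs : ∀ v w, b v w = b w v := by
    intro v w
    rw [hb, hb]
    conv_lhs => rw [← hB w]
    rw [← hsymm, hB, real_inner_comm]
  -- The constant combines `b z z ≥ lam ‖B z‖ ^ 2` with `‖z‖ ≤ (‖aL‖ + 1) ‖B z‖`; the added `1`
  -- keeps the denominator positive.
  refine ⟨b, lam / (‖aL‖ + 1) ^ 2, by positivity, hbs, fun z => ?_, fun z => ?_, ?_⟩
  · have h1 : ‖z‖ ≤ (‖aL‖ + 1) * ‖B z‖ := by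
      have : ‖aL (B z)‖ ≤ ‖aL‖ * ‖B z‖ := aL.le_opNorm _
      have h2 : aL (B z) = z := hB z
      rw [h2] at this
      linarith [norm_nonneg (B z)]
    have h3 := hA (B z)
    rw [← hq, hB, real_inner_comm, ← hb] at h3
    refine le_trans ?_ h3
    rw [div_mul_eq_mul_div, div_le_iff₀ (by positivity)]
    have h4 : ‖z‖ ^ 2 ≤ ((‖aL‖ + 1) * ‖B z‖) ^ 2 := by gcongr
    nlinarith [mul_le_mul_of_nonneg_left h4 hlam.le]
  · simp only [hb, euc_inner_single_right]
    conv_rhs => rw [real_inner_comm]; arg 2; rw [← hB z]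
    rw [hq]
    simp only [mul_assoc]
  · have h1 : ∑ i, ∑ j, A j i * b (EuclideanSpace.single j 1) (EuclideanSpace.single i 1)
        = ∑ i, ∑ j, A i j * b (EuclideanSpace.single i 1) (EuclideanSpace.single j 1) :=
      Finset.sum_comm
    have h2 : ∑ i, ∑ j, (A i j + A j i) / 2 * b (EuclideanSpace.single i 1)
        (EuclideanSpace.single j 1) = (n : ℝ) := by
      have : ∀ i : Fin n, ∑ j, (A i j + A j i) / 2 * b (EuclideanSpace.single i 1)
          (EuclideanSpace.single j 1) = 1 := by
        intro i
        have h3 : inner ℝ (a (B (EuclideanSpace.single i 1))) (EuclideanSpace.single i (1 : ℝ))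
            = (1 : ℝ) := by rw [hB, euc_inner_single_right]; simp
        rw [euc_inner_single_right] at h3
        refine Eq.trans ?_ h3
        simp only [hb, euc_inner_single_right]
        rfl
      simp [this]
    rw [← h2]
    have h3 : ∑ i, ∑ j, (A i j + A j i) / 2 * b (EuclideanSpace.single i 1)
        (EuclideanSpace.single j 1)
        = (∑ i, ∑ j, A i j * b (EuclideanSpace.single i 1) (EuclideanSpace.single j 1)) / 2
        + (∑ i, ∑ j, A j i * b (EuclideanSpace.single j 1) (EuclideanSpace.single i 1)) / 2 := by
      rw [Finset.sum_div, Finset.sum_div, ← Finset.sum_add_distrib]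
      refine Finset.sum_congr rfl fun i _ => ?_
      rw [Finset.sum_div, Finset.sum_div, ← Finset.sum_add_distrib]
      refine Finset.sum_congr rfl fun j _ => ?_
      rw [hbs (EuclideanSpace.single j 1)]; ring
    rw [h3, h1]; ring

theorem hasFDerivAt_comp_form {b : Euc n →L[ℝ] Euc n →L[ℝ] ℝ} (hb : ∀ v w, b v w = b w v)
    {g : ℝ → ℝ} (hg : Differentiable ℝ g) (z : Euc n) :
    HasFDerivAt (fun z => g (b z z)) ((2 * deriv g (b z z)) • b z) z := by
  have h1 : HasFDerivAt (fun z : Euc n => b z z) ((2 : ℝ) • b z) z := by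
    refine (b.hasFDerivAt.clm_apply (hasFDerivAt_id z)).congr_fderiv ?_
    ext v
    simp [hb v z, two_mul]
  refine (HasDerivAt.comp_hasFDerivAt (f := fun z => b z z) z (hg (b z z)).hasDerivAt h1).congr_fderiv ?_
  rw [smul_smul, mul_comm]

/-- An averaging kernel `φ` whose dilation generator is `A : D²η` for a compactly supported `η`. -/
theorem exists_elliptic_kernel (hn : 0 < n) (A : Fin n → Fin n → ℝ) {lam : ℝ} (hlam : 0 < lam)
    (hA : ∀ ξ : Euc n, lam * ‖ξ‖ ^ 2 ≤ ∑ i, ∑ j, A i j * ξ i * ξ j) :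
    ∃ η φ : Euc n → ℝ, ContDiff ℝ 3 η ∧ HasCompactSupport η ∧ ContDiff ℝ 1 φ ∧
      HasCompactSupport φ ∧ ∫ z, φ z = 1 ∧
      ∀ z, ∑ i, ∑ j, A i j * fderiv ℝ (fderiv ℝ η) z (EuclideanSpace.single i 1)
        (EuclideanSpace.single j 1) = dilationGenerator φ z := by
  obtain ⟨b, c, hc, hbs, hbc, hbA, hbn⟩ := exists_inverse_form A hlam hA
  have hsupp : ∀ (h : ℝ → ℝ), (∀ t, 1 < t → h t = 0) →
      HasCompactSupport fun z : Euc n => h (b z z) := by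
    intro h hh
    refine HasCompactSupport.intro (isCompact_closedBall (0 : Euc n) (√(1 / c))) fun z hz => hh _ ?_
    rw [mem_closedBall_zero_iff, not_le] at hz
    have h1 := (Real.sqrt_lt' (lt_of_le_of_lt (Real.sqrt_nonneg _) hz)).1 hz
    rw [div_lt_iff₀' hc] at h1
    exact h1.trans_le (hbc z)
  -- A smooth decreasing cutoff, equal to `1` for `t ≤ 0` and to `0` for `t ≥ 1`. Monotonicity makes
  -- `-2 g₀'` nonnegative, so its integral can be normalized.
  let g₀ : ℝ → ℝ := fun t => Real.smoothTransition (1 - t)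
  have hg₀ : ∀ k : ℕ, ContDiff ℝ k g₀ := fun k =>
    Real.smoothTransition.contDiff.comp (contDiff_const.sub contDiff_id)
  have hg₀a : Antitone g₀ := fun s t hst => Real.smoothTransition.monotone (by linarith)
  have hd₀ : ∀ t, deriv g₀ t ≤ 0 := fun t => hg₀a.deriv_nonpos
  have hg₀1 : ∀ t, 1 < t → g₀ t = 0 := fun t ht =>
    Real.smoothTransition.zero_of_nonpos (by linarith)
  have hd₀1 : ∀ t, 1 < t → deriv g₀ t = 0 := fun t ht => by
    have : g₀ =ᶠ[𝓝 t] fun _ => 0 := by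
      filter_upwards [lt_mem_nhds ht] with s hs using hg₀1 s hs
    rw [this.deriv_eq, deriv_const]
  have hd₀c : ∀ k : ℕ, ContDiff ℝ k (deriv g₀) := fun k =>
    (contDiff_succ_iff_deriv.1 (by exact_mod_cast hg₀ (k + 1) :
      ContDiff ℝ ((k : WithTop ℕ∞) + 1) g₀)).2.2
  have hquad : ∀ k : ℕ, ContDiff ℝ k fun z : Euc n => b z z := fun k =>
    b.contDiff.clm_apply contDiff_id
  have hφ₀c : Continuous fun z : Euc n => -2 * deriv g₀ (b z z) :=
    continuous_const.mul ((hd₀c 0).continuous.comp (hquad 0).continuous)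
  have hφ₀s : HasCompactSupport fun z : Euc n => -2 * deriv g₀ (b z z) :=
    hsupp (fun t => -2 * deriv g₀ t) fun t ht => by simp [hd₀1 t ht]
  obtain ⟨κ, hκ⟩ : ∃ κ : ℝ, κ * ∫ z : Euc n, -2 * deriv g₀ (b z z) = 1 := by
    refine ⟨(∫ z : Euc n, -2 * deriv g₀ (b z z))⁻¹, inv_mul_cancel₀ ?_⟩
    -- A point where `g₀'` is the slope `-1` of `g₀` over `[0, 1]`; a multiple of a basis vector on
    -- the level set `b z z = t` shows that the kernel is not identically zero.
    obtain ⟨t, ht, htd⟩ := exists_deriv_eq_slope g₀ one_pos (hg₀ 0).continuous.continuousOn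
      ((hg₀ 1).differentiable one_ne_zero).differentiableOn
    have htne : deriv g₀ t ≠ 0 := by
      rw [htd]; simp [g₀]
    let w : Euc n := EuclideanSpace.single ⟨0, hn⟩ 1
    have hw : 0 < b w w := lt_of_lt_of_le (by simp [w, hc]) (hbc w)
    refine (hφ₀c.integral_pos_of_hasCompactSupport_nonneg_nonzero hφ₀s
      (fun z => mul_nonneg_of_nonpos_of_nonpos (by norm_num) (hd₀ _)) (x := √(t / b w w) • w) ?_).ne'
    have : b (√(t / b w w) • w) (√(t / b w w) • w) = t := by
      simp only [map_smul, smul_apply, smul_eq_mul]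
      rw [← mul_assoc, Real.mul_self_sqrt (div_nonneg ht.1.le hw.le), div_mul_cancel₀ _ hw.ne']
    rw [this]
    simpa using htne
  let g : ℝ → ℝ := fun t => κ * g₀ t
  have hg : ∀ k : ℕ, ContDiff ℝ k g := fun k => contDiff_const.mul (hg₀ k)
  have hgd : deriv g = fun t => κ * deriv g₀ t := by
    funext t; exact deriv_const_mul _ ((hg₀ 1).differentiable one_ne_zero t)
  have hdc : ∀ k : ℕ, ContDiff ℝ k (deriv g) := fun k => by
    rw [hgd]; exact contDiff_const.mul (hd₀c k)
  have hη1 : fderiv ℝ (fun z : Euc n => g (b z z)) = fun z => (2 * deriv g (b z z)) • b z :=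
    funext fun z => (hasFDerivAt_comp_form hbs ((hg 1).differentiable one_ne_zero) z).fderiv
  have hη2 : ∀ z v w : Euc n, fderiv ℝ (fderiv ℝ (fun z : Euc n => g (b z z))) z v w =
      4 * deriv (deriv g) (b z z) * (b z v * b z w) + 2 * deriv g (b z z) * b v w := by
    intro z v w
    rw [hη1]
    have h1 := ((hasFDerivAt_comp_form hbs ((hdc 1).differentiable one_ne_zero) z).const_mul 2).smul
      (b.hasFDerivAt (x := z))
    have h2 := h1.fderiv
    simp only [Pi.smul_def'] at h2
    rw [h2]
    simp only [add_apply, smul_apply, ContinuousLinearMap.smulRight_apply, smul_eq_mul]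
    ring
  -- With `η = g (b z z)` and `φ = -2 g' (b z z)`, both `A : D²η` and `-(n φ + Dφ(z) z)` equal `4
  -- g'' (b z z) b z z + 2 n g' (b z z)`, by the two contraction identities for `b`.
  refine ⟨fun z => g (b z z), fun z => -2 * deriv g (b z z), (hg 3).comp (hquad 3),
    hsupp g fun t ht => by simp [g, hg₀1 t ht], contDiff_const.mul ((hdc 1).comp (hquad 1)),
    hsupp (fun t => -2 * deriv g t) fun t ht => by simp [hgd, hd₀1 t ht], ?_, fun z => ?_⟩
  · rw [← hκ, ← integral_const_mul]
    congr 1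
    funext z
    rw [hgd]; ring
  · have h1 := (hasFDerivAt_comp_form hbs ((hdc 1).differentiable one_ne_zero) z).const_mul (-2)
    rw [dilationGenerator, h1.fderiv]
    simp only [hη2, mul_add, Finset.sum_add_distrib, smul_apply, smul_eq_mul]
    have e1 : ∑ i, ∑ j, A i j * (4 * deriv (deriv g) (b z z) *
        (b z (EuclideanSpace.single i 1) * b z (EuclideanSpace.single j 1)))
        = 4 * deriv (deriv g) (b z z) * b z z := by
      refine Eq.trans ?_ (congrArg (4 * deriv (deriv g) (b z z) * ·) (hbA z))
      simp only [Finset.mul_sum]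
      exact Finset.sum_congr rfl fun i _ => Finset.sum_congr rfl fun j _ => by ring
    have e2 : ∑ i, ∑ j, A i j * (2 * deriv g (b z z) *
        b (EuclideanSpace.single i 1) (EuclideanSpace.single j 1))
        = 2 * deriv g (b z z) * n := by
      conv_rhs => rw [← hbn]
      simp only [Finset.mul_sum]
      exact Finset.sum_congr rfl fun i _ => Finset.sum_congr rfl fun j _ => by ring
    rw [e1, e2]; ring

end EllipticKernel

/-! ### Approximate right inverse of the constant coefficient operator -/

section RightInverse

variable {n : ℕ} {F : Type*} [NormedAddCommGroup F] [NormedSpace ℝ F]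

/-- The contraction `∑ i j, A i j • T e_i e_j` of a bilinear map `T` with the matrix `A`. -/
noncomputable def matrixContraction (A : Fin n → Fin n → ℝ) :
    (Euc n →L[ℝ] Euc n →L[ℝ] F) →L[ℝ] F :=
  ∑ i, ∑ j, A i j • (ContinuousLinearMap.apply ℝ F (EuclideanSpace.single j (1 : ℝ))).comp
    (ContinuousLinearMap.apply ℝ (Euc n →L[ℝ] F) (EuclideanSpace.single i (1 : ℝ)))

theorem matrixContraction_apply (A : Fin n → Fin n → ℝ) (T : Euc n →L[ℝ] Euc n →L[ℝ] F) :
    matrixContraction A T =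
      ∑ i, ∑ j, A i j • T (EuclideanSpace.single i 1) (EuclideanSpace.single j 1) := by
  simp [matrixContraction]

/-- Carries the contraction with `A` through the integrals over `s` and `z` onto the kernel;
integrability in `s` of the result is inherited from the mean zero kernel `ψ`. -/
theorem map_integral_inv_smul_scaledConv {G H G' H' : Type*} [NormedAddCommGroup G]
    [NormedSpace ℝ G] [NormedAddCommGroup H] [NormedSpace ℝ H] [NormedAddCommGroup G']
    [NormedSpace ℝ G'] [NormedAddCommGroup H'] [NormedSpace ℝ H'] [CompleteSpace G]
    [CompleteSpace H] [CompleteSpace H'] (L : G →L[ℝ] F →L[ℝ] H) (L' : G' →L[ℝ] F →L[ℝ] H')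
    (T : H →L[ℝ] H') {ψ : Euc n → G} {χ : Euc n → G'} (hT : ∀ z v, T (L (ψ z) v) = L' (χ z) v)
    {α M S : ℝ} (hα : 0 < α) (hψ : Continuous ψ) (hψc : HasCompactSupport ψ)
    (hψ0 : ∫ z, ψ z = 0) {f : Euc n → F} (hf : HolderBounded α univ M f) (hS : 0 ≤ S)
    (x : Euc n) :
    IntervalIntegrable (fun s => s⁻¹ • scaledConv L' χ f s x) volume 0 S ∧
      T (∫ s in 0..S, s⁻¹ • scaledConv L ψ f s x) = ∫ s in 0..S, s⁻¹ • scaledConv L' χ f s x := by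
  have hii : IntervalIntegrable (fun s => s⁻¹ • scaledConv L ψ f s x) volume 0 S := by
    simpa only [one_mul] using intervalIntegrable_inv_smul_scaledConv L hα (w := fun _ => 1)
      (c := 1) continuous_const (fun s _ => by simp) hψ hψc hψ0 hf hS x
  have hcomm : ∀ s, T (s⁻¹ • scaledConv L ψ f s x) = s⁻¹ • scaledConv L' χ f s x := by
    intro s
    rw [map_smul, scaledConv, ← ContinuousLinearMap.integral_comp_comm _
      (integrable_scaledConv_integrand L hψ hψc (hf.continuous hα) s x), scaledConv]
    simp only [hT]
  have hint := T.intervalIntegral_comp_comm hii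
  simp only [hcomm] at hint
  refine ⟨?_, hint.symm⟩
  rw [intervalIntegrable_iff, IntegrableOn] at hii ⊢
  simpa only [hcomm] using T.integrable_comp hii

theorem scaledConv_sub {G H : Type*} [NormedAddCommGroup G] [NormedSpace ℝ G]
    [NormedAddCommGroup H] [NormedSpace ℝ H] (L : G →L[ℝ] F →L[ℝ] H) {ψ : Euc n → G}
    (hψ : Continuous ψ) (hψc : HasCompactSupport ψ) {f g : Euc n → F} (hf : Continuous f)
    (hg : Continuous g) (s : ℝ) (x : Euc n) :
    scaledConv L ψ (fun y => f y - g y) s x = scaledConv L ψ f s x - scaledConv L ψ g s x := by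
  rw [scaledConv, scaledConv, scaledConv, ← integral_sub
    (integrable_scaledConv_integrand L hψ hψc hf s x)
    (integrable_scaledConv_integrand L hψ hψc hg s x)]
  simp only [map_sub]

variable [CompleteSpace F]

set_option maxHeartbeats 1000000 in
/-- A Hölder continuous approximate right inverse of the constant coefficient operator `A : D²`;
the error is a Lipschitz function with small constant. -/
theorem exists_approx_right_inverse (hn : 0 < n) (A : Fin n → Fin n → ℝ) {lam : ℝ} (hlam : 0 < lam)
    (hA : ∀ ξ : Euc n, lam * ‖ξ‖ ^ 2 ≤ ∑ i, ∑ j, A i j * ξ i * ξ j)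
    {α δ : ℝ} (hα : 0 < α) (hα1 : α < 1) (hδ : 0 < δ) :
    ∃ (C : ℝ) (P : (Euc n → F) → Euc n → F), 0 ≤ C ∧
      (∀ (f g : Euc n → F) (M N : ℝ), HolderBounded α univ M f → HolderBounded α univ N g →
        P (fun x => f x - g x) = fun x => P f x - P g x) ∧
      ∀ (f : Euc n → F) (M : ℝ), HolderBounded α univ M f →
        ContDiff ℝ 2 (P f) ∧
        HolderBounded α univ (C * M) (fderiv ℝ (fderiv ℝ (P f))) ∧
        ∀ x y, ‖(matrixContraction A (fderiv ℝ (fderiv ℝ (P f)) x) - f x)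
          - (matrixContraction A (fderiv ℝ (fderiv ℝ (P f)) y) - f y)‖ ≤ δ * M * ‖x - y‖ := by
  obtain ⟨η, φ, hη, hηc, hφ, hφc, hφ1, hηφ⟩ := exists_elliptic_kernel hn A hlam hA
  have hη1 : ContDiff ℝ 2 (fderiv ℝ η) := hη.fderiv_right (by norm_num)
  have hη2 : ContDiff ℝ 1 (fderiv ℝ (fderiv ℝ η)) := hη1.fderiv_right (by norm_num)
  have hη1c : HasCompactSupport (fderiv ℝ η) := hηc.fderiv (𝕜 := ℝ)
  have hη2c : HasCompactSupport (fderiv ℝ (fderiv ℝ η)) := hη1c.fderiv (𝕜 := ℝ)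
  have hη20 := integral_fderiv_eq_zero (hη1.of_le (by norm_num)) hη1c
  let L0 : ℝ →L[ℝ] F →L[ℝ] F := ContinuousLinearMap.lsmul ℝ ℝ
  let L1 : (Euc n →L[ℝ] ℝ) →L[ℝ] F →L[ℝ] (Euc n →L[ℝ] F) := L0.precompL (Euc n)
  let L2 : (Euc n →L[ℝ] Euc n →L[ℝ] ℝ) →L[ℝ] F →L[ℝ] (Euc n →L[ℝ] Euc n →L[ℝ] F) :=
    L1.precompL (Euc n)
  let k2 (f : Euc n → F) (s : ℝ) (x : Euc n) : Euc n →L[ℝ] Euc n →L[ℝ] F :=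
    scaledConv (H := Euc n →L[ℝ] Euc n →L[ℝ] F) L2 (fderiv ℝ (fderiv ℝ η)) f s x
  set c₀ := kernelMass L1 (fderiv ℝ φ) with hc₀
  have hc₀0 : 0 ≤ c₀ := kernelMass_nonneg _ _
  -- The error will be `φ_S * f`, with Lipschitz constant at most `S⁻¹ c₀ M`; this `S` makes it at
  -- most `δ M`.
  set S : ℝ := (c₀ + 1) / δ with hSdef
  have hS : 0 < S := by positivity
  obtain ⟨C, hC0, hC⟩ := exists_holderBounded_integral_inv_smul_scaledConv (F := F)
    (H := Euc n →L[ℝ] Euc n →L[ℝ] F) L2 hα hα1 hη2 hη2c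
    hη20 hS
  -- Two differentiations turn the weight `s` into `s⁻¹`, for which the Hölder estimate holds.
  let P : (Euc n → F) → Euc n → F := fun f x => -∫ s in 0..S, s • scaledConv L0 η f s x
  have hP1 : ∀ (f : Euc n → F) (M : ℝ), HolderBounded α univ M f →
      fderiv ℝ (P f) = fun x => -∫ s in 0..S, (1 : ℝ) • scaledConv L1 (fderiv ℝ η) f s x := by
    intro f M hf
    funext x
    have h := (hasFDerivAt_integral_scaledConv L0 hα (w := fun s => s) (c := S) continuous_id
      (fun s hs => by rw [abs_of_pos hs.1]; exact hs.2) (hη.of_le (by norm_num)) hηc hf hS.le x).neg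
    refine h.fderiv.trans ?_
    congr 1
    refine intervalIntegral.integral_congr_ae (Eventually.of_forall fun s hs => ?_)
    rw [uIoc_of_le hS.le] at hs
    rw [mul_inv_cancel₀ hs.1.ne']
  have hP1d : ∀ (f : Euc n → F) (M : ℝ), HolderBounded α univ M f → Differentiable ℝ (P f) := by
    intro f M hf x
    exact (hasFDerivAt_integral_scaledConv L0 hα (w := fun s => s) (c := S) continuous_id
      (fun s hs => by rw [abs_of_pos hs.1]; exact hs.2) (hη.of_le (by norm_num)) hηc hf hS.le
      x).neg.differentiableAt
  have hP2 : ∀ (f : Euc n → F) (M : ℝ), HolderBounded α univ M f → ∀ x,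
      HasFDerivAt (fderiv ℝ (P f))
        (-∫ s in 0..S, s⁻¹ • k2 f s x) x := by
    intro f M hf x
    rw [hP1 f M hf]
    have h := (hasFDerivAt_integral_scaledConv L1 hα (w := fun _ => 1) (c := 1)
      continuous_const (fun s hs => by simp) (hη1.of_le (by norm_num)) hη1c hf hS.le x).neg
    simp only [one_mul] at h
    exact h
  have hP2' : ∀ (f : Euc n → F) (M : ℝ), HolderBounded α univ M f →
      fderiv ℝ (fderiv ℝ (P f)) = fun x =>
        -∫ s in 0..S, s⁻¹ • k2 f s x :=
    fun f M hf => funext fun x => (hP2 f M hf x).fderiv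
  refine ⟨C, P, hC0, fun f g M N hf hg => ?_, fun f M hf => ?_⟩
  · funext x
    have hii : ∀ {h : Euc n → F} {K : ℝ}, HolderBounded α univ K h →
        IntervalIntegrable (fun s => s • scaledConv L0 η h s x) volume 0 S := fun hh =>
      (continuous_id.smul (continuous_scaledConv_scale L0 hη.continuous hηc (hh.continuous hα)
        (fun x => hh.1 x (mem_univ _)) x)).intervalIntegrable _ _
    simp only [P, scaledConv_sub L0 hη.continuous hηc (hf.continuous hα) (hg.continuous hα),
      smul_sub]
    rw [intervalIntegral.integral_sub (hii hf) (hii hg), neg_sub_neg, neg_sub]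
  · have hfc := hf.continuous hα
    have hfM : ∀ x, ‖f x‖ ≤ M := fun x => hf.1 x (mem_univ _)
    have hHB : HolderBounded α univ (C * M) (fderiv ℝ (fderiv ℝ (P f))) := by
      rw [hP2' f M hf]
      exact (hC f M hf).neg
    refine ⟨?_, hHB, ?_⟩
    · rw [show (2 : WithTop ℕ∞) = 1 + 1 by norm_num, contDiff_succ_iff_fderiv]
      refine ⟨hP1d f M hf, by simp, contDiff_one_iff_fderiv.2
        ⟨fun x => (hP2 f M hf x).differentiableAt, hHB.continuous hα⟩⟩
    -- Contracting `D²η` with `A` gives `dilationGenerator φ`, so the integrand is the derivative in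
    -- `s` of `φ_s * f`. The integral is the difference of the values at `S` and at `0`, and the
    -- latter is `f` since `φ` has mass one.
    · have key : ∀ x, matrixContraction A (fderiv ℝ (fderiv ℝ (P f)) x) - f x
          = -scaledConv L0 φ f S x := by
        intro x
        obtain ⟨hii2, hint⟩ := map_integral_inv_smul_scaledConv
          (H := Euc n →L[ℝ] Euc n →L[ℝ] F) L2 L0 (matrixContraction A)
          (χ := dilationGenerator φ) (fun z v => by
            rw [matrixContraction_apply, ← hηφ z]
            simp [L0, L1, L2, smul_smul]) hα hη2.continuous hη2c hη20 hf hS.le x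
        rw [intervalIntegral.integral_eq_sub_of_hasDerivAt_of_le hS.le
          (continuous_scaledConv_scale L0 hφ.continuous hφc hfc hfM x).continuousOn
          (fun s hs => hasDerivAt_scaledConv_scale hφ hφc hfc hfM hs.1 x) hii2] at hint
        have h0 : scaledConv L0 φ f 0 x = f x := by
          simp [scaledConv, L0, integral_smul_const, hφ1]
        rw [hP2' f M hf, map_neg, hint, h0]
        abel
      intro x y
      rw [key, key, neg_sub_neg, norm_sub_rev]
      refine (norm_scaledConv_sub_le L0 hφ hφc hfc hS
        (fun z => norm_scaledConv_le _ (hφ.continuous_fderiv one_ne_zero) (hφc.fderiv (𝕜 := ℝ))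
          hfM S z) x y).trans ?_
      have hM0 : 0 ≤ M := hf.nonneg (mem_univ 0)
      have : S⁻¹ * c₀ ≤ δ := by
        rw [hSdef, inv_div, div_mul_eq_mul_div, div_le_iff₀ (by positivity)]
        nlinarith
      rw [← mul_assoc]
      gcongr

end RightInverse

/-! ### Normalization at the origin -/

section Normalization

variable {n : ℕ} {F : Type*} [NormedAddCommGroup F] [NormedSpace ℝ F]

theorem le_two_mul_rpow {t α : ℝ} (hα : 0 < α) (hα1 : α < 1) (ht : 0 ≤ t) (ht2 : t ≤ 2) :
    t ≤ 2 * t ^ α := by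
  rcases ht.eq_or_lt with rfl | h
  · simp [Real.zero_rpow hα.ne']
  calc t = t ^ (1 - α) * t ^ α := by
        rw [← Real.rpow_add h, sub_add_cancel, Real.rpow_one]
    _ ≤ 2 ^ (1 - α) * t ^ α := by
        have : 0 ≤ 1 - α := by linarith
        gcongr
    _ ≤ 2 ^ (1 : ℝ) * t ^ α := by
        gcongr
        · norm_num
        · linarith
    _ = _ := by rw [Real.rpow_one]

theorem norm_sub_le_two_mul_rpow {E : Type*} [NormedAddCommGroup E] {α : ℝ} (hα : 0 < α)
    (hα1 : α < 1) {x y : E} (hx : x ∈ closedBall (0 : E) 1) (hy : y ∈ closedBall (0 : E) 1) :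
    ‖x - y‖ ≤ 2 * ‖x - y‖ ^ α := by
  rw [mem_closedBall_zero_iff] at hx hy
  exact le_two_mul_rpow hα hα1 (norm_nonneg _) (by linarith [norm_sub_le x y])

theorem HolderBounded.const {E F : Type*} [NormedAddCommGroup E] [NormedAddCommGroup F] {c : F}
    {α M : ℝ} {s : Set E} (hc : ‖c‖ ≤ M) : HolderBounded α s M fun _ => c := by
  have hM : 0 ≤ M := (norm_nonneg _).trans hc
  refine ⟨fun _ _ => hc, fun x _ y _ => ?_⟩
  rw [sub_self, norm_zero]
  positivity

theorem HolderBounded.of_lipschitz {E F : Type*} [NormedAddCommGroup E] [NormedAddCommGroup F]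
    {g : E → F} {α M N : ℝ}
    (hα : 0 < α) (hα1 : α < 1) (hM0 : 0 ≤ M) (hN : ∀ x ∈ closedBall (0 : E) 1, ‖g x‖ ≤ N)
    (hNM : N ≤ 2 * M)
    (hM : ∀ x ∈ closedBall (0 : E) 1, ∀ y ∈ closedBall (0 : E) 1, ‖g x - g y‖ ≤ M * ‖x - y‖) :
    HolderBounded α (closedBall 0 1) (2 * M) g := by
  refine ⟨fun x hx => (hN x hx).trans hNM, fun x hx y hy => (hM x hx y hy).trans ?_⟩
  have := mul_le_mul_of_nonneg_left (norm_sub_le_two_mul_rpow hα hα1 hx hy) hM0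
  linarith

theorem norm_le_of_lipschitz_of_zero {E F : Type*} [NormedAddCommGroup E] [NormedAddCommGroup F]
    {g : E → F} {M : ℝ}
    (hM0 : 0 ≤ M) (h0 : g 0 = 0)
    (hM : ∀ x ∈ closedBall (0 : E) 1, ∀ y ∈ closedBall (0 : E) 1, ‖g x - g y‖ ≤ M * ‖x - y‖) :
    ∀ x ∈ closedBall (0 : E) 1, ‖g x‖ ≤ M := by
  intro x hx
  have h := hM x hx 0 (by simp)
  rw [h0, sub_zero, sub_zero] at h
  rw [mem_closedBall_zero_iff] at hx
  exact h.trans (mul_le_of_le_one_right hM0 hx)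

theorem lipschitz_of_norm_fderiv_le {E : Type*} [NormedAddCommGroup E] [NormedSpace ℝ E]
    {g : E → F} {M : ℝ} (hg : Differentiable ℝ g)
    (hM : ∀ x ∈ closedBall (0 : E) 1, ‖fderiv ℝ g x‖ ≤ M) :
    ∀ x ∈ closedBall (0 : E) 1, ∀ y ∈ closedBall (0 : E) 1, ‖g x - g y‖ ≤ M * ‖x - y‖ :=
  fun _ hx _ hy => (convex_closedBall 0 1).norm_image_sub_le_of_norm_fderiv_le (𝕜 := ℝ)
    (fun z _ => hg z) hM hy hx

/-- The bilinear form `(v, w) ↦ vᵢ wᵢ • p`. -/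
noncomputable def diagForm (i : Fin n) (p : F) : Euc n →L[ℝ] Euc n →L[ℝ] F :=
  (EuclideanSpace.proj (𝕜 := ℝ) i).smulRight ((EuclideanSpace.proj (𝕜 := ℝ) i).smulRight p)

theorem diagForm_apply (i : Fin n) (p : F) (v w : Euc n) :
    diagForm i p v w = (v i * w i) • p := by
  simp [diagForm, smul_smul]

theorem norm_diagForm_le (i : Fin n) (p : F) : ‖diagForm i p‖ ≤ ‖p‖ := by
  refine ContinuousLinearMap.opNorm_le_bound₂ _ (norm_nonneg _) fun v w => ?_
  rw [diagForm_apply, norm_smul, norm_mul]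
  have h1 := PiLp.norm_apply_le v i
  have h2 := PiLp.norm_apply_le w i
  calc _ ≤ ‖v‖ * ‖w‖ * ‖p‖ := by gcongr
    _ = _ := by ring

theorem norm_matrixContraction_le (A : Fin n → Fin n → ℝ) (T : Euc n →L[ℝ] Euc n →L[ℝ] F) :
    ‖matrixContraction A T‖ ≤ (∑ i, ∑ j, |A i j|) * ‖T‖ := by
  rw [matrixContraction_apply, Finset.sum_mul]
  refine norm_sum_le_of_le _ fun i _ => ?_
  rw [Finset.sum_mul]
  refine norm_sum_le_of_le _ fun j _ => ?_
  rw [norm_smul, Real.norm_eq_abs]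
  gcongr
  refine (T.le_opNorm₂ _ _).trans ?_
  simp

theorem matrixContraction_diagForm (A : Fin n → Fin n → ℝ) (i : Fin n) (p : F) :
    matrixContraction A (diagForm i p) = A i i • p := by
  rw [matrixContraction_apply]
  simp only [diagForm_apply, PiLp.single_apply, smul_smul]
  rw [Finset.sum_eq_single i]
  · rw [Finset.sum_eq_single i]
    · simp
    · intro j _ hj
      simp [hj.symm]
    · simp
  · intro j _ hj
    simp [hj.symm]
  · simp

/-- The quadratic map with Hessian `T`. -/
noncomputable def quadraticMap (T : Euc n →L[ℝ] Euc n →L[ℝ] F) (x : Euc n) : F :=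
  (1 / 2 : ℝ) • T x x

theorem hasFDerivAt_quadraticMap {T : Euc n →L[ℝ] Euc n →L[ℝ] F} (hT : ∀ v w, T v w = T w v)
    (x : Euc n) : HasFDerivAt (quadraticMap T) (T x) x := by
  refine ((T.hasFDerivAt.clm_apply (hasFDerivAt_id x)).const_smul (1 / 2 : ℝ)).congr_fderiv ?_
  ext v
  simp [hT v x, ← two_smul ℝ, smul_smul]

theorem contDiff_quadraticMap (T : Euc n →L[ℝ] Euc n →L[ℝ] F) :
    ContDiff ℝ 2 (quadraticMap T) :=
  contDiff_const.smul (T.contDiff.clm_apply contDiff_id)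

theorem fderiv_quadraticMap {T : Euc n →L[ℝ] Euc n →L[ℝ] F} (hT : ∀ v w, T v w = T w v) :
    fderiv ℝ (quadraticMap T) = T :=
  funext fun x => (hasFDerivAt_quadraticMap hT x).fderiv

theorem fderiv_fderiv_sub {f g : Euc n → F} (hf : ContDiff ℝ 2 f) (hg : ContDiff ℝ 2 g) :
    (fderiv ℝ fun x => f x - g x) = (fun x => fderiv ℝ f x - fderiv ℝ g x) ∧
    (fderiv ℝ (fderiv ℝ fun x => f x - g x)) =
      fun x => fderiv ℝ (fderiv ℝ f) x - fderiv ℝ (fderiv ℝ g) x := by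
  have h1 : (fderiv ℝ fun x => f x - g x) = fun x => fderiv ℝ f x - fderiv ℝ g x :=
    funext fun x => fderiv_fun_sub (hf.differentiable two_ne_zero x)
      (hg.differentiable two_ne_zero x)
  refine ⟨h1, ?_⟩
  rw [h1]
  exact funext fun x => fderiv_fun_sub
    ((hf.fderiv_right (m := 1) (by norm_num)).differentiable one_ne_zero x)
    ((hg.fderiv_right (m := 1) (by norm_num)).differentiable one_ne_zero x)

/-- An elliptic matrix has positive diagonal entries. -/
theorem diag_pos_of_elliptic (A : Fin n → Fin n → ℝ) {lam : ℝ} (hlam : 0 < lam)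
    (hA : ∀ ξ : Euc n, lam * ‖ξ‖ ^ 2 ≤ ∑ i, ∑ j, A i j * ξ i * ξ j) (i : Fin n) : 0 < A i i := by
  have h := hA (EuclideanSpace.single i 1)
  have h2 : ∑ k, ∑ j, A k j * (EuclideanSpace.single i (1 : ℝ) : Euc n) k *
      (EuclideanSpace.single i (1 : ℝ) : Euc n) j = A i i := by
    rw [Finset.sum_eq_single i]
    · rw [Finset.sum_eq_single i] <;> simp +contextual
    · intro j _ hj
      simp [hj]
    · simp
  rw [h2] at h
  simp at h
  linarith

variable [CompleteSpace F]

/-- An approximate right inverse of `A : D²` whose values vanish to first order at the origin, have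
a vanishing pure second derivative there, and solve the equation exactly there. -/
theorem exists_normalized_right_inverse {i₀ i₁ : Fin n} (hi : i₀ ≠ i₁) (A : Fin n → Fin n → ℝ)
    {lam : ℝ} (hlam : 0 < lam)
    (hA : ∀ ξ : Euc n, lam * ‖ξ‖ ^ 2 ≤ ∑ i, ∑ j, A i j * ξ i * ξ j)
    {α δ : ℝ} (hα : 0 < α) (hα1 : α < 1) (hδ : 0 < δ) :
    ∃ (C : ℝ) (P : (Euc n → F) → Euc n → F), 0 ≤ C ∧
      (∀ (f g : Euc n → F) (M N : ℝ), HolderBounded α univ M f → HolderBounded α univ N g →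
        P (fun x => f x - g x) = fun x => P f x - P g x) ∧
      ∀ (f : Euc n → F) (M : ℝ), HolderBounded α univ M f →
        ContDiff ℝ 2 (P f) ∧ P f 0 = 0 ∧ fderiv ℝ (P f) 0 = 0 ∧
        fderiv ℝ (fderiv ℝ (P f)) 0 (EuclideanSpace.single i₀ 1) (EuclideanSpace.single i₀ 1) = 0 ∧
        (∀ x ∈ closedBall (0 : Euc n) 1, ‖P f x‖ ≤ C * M) ∧
        (∀ x ∈ closedBall (0 : Euc n) 1, ‖fderiv ℝ (P f) x‖ ≤ C * M) ∧
        HolderBounded α univ (C * M) (fderiv ℝ (fderiv ℝ (P f))) ∧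
        HolderBounded α (closedBall 0 1) (δ * M)
          fun x => f x - matrixContraction A (fderiv ℝ (fderiv ℝ (P f)) x) := by
  obtain ⟨C, P, hC, hPlin, hP⟩ := exists_approx_right_inverse (F := F) i₀.pos A hlam hA hα hα1
    (half_pos hδ)
  have hA1 : 0 < A i₁ i₁ := diag_pos_of_elliptic A hlam hA i₁
  let p (f : Euc n → F) : F := fderiv ℝ (fderiv ℝ (P f)) 0 (EuclideanSpace.single i₀ 1)
    (EuclideanSpace.single i₀ 1)
  -- The entry `p f` at `i₀` removes the pure second derivative at `0`. The entry `r f` at `i₁` is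
  -- then chosen so that `A : T f` equals the error of `P` at `0`; this uses `A i₁ i₁ > 0` and a
  -- second coordinate direction.
  let r (f : Euc n → F) : F :=
    (A i₁ i₁)⁻¹ • (matrixContraction A (fderiv ℝ (fderiv ℝ (P f)) 0) - f 0 - A i₀ i₀ • p f)
  let T (f : Euc n → F) : Euc n →L[ℝ] Euc n →L[ℝ] F := diagForm i₀ (p f) + diagForm i₁ (r f)
  have hTsymm : ∀ f v w, T f v w = T f w v := by
    intro f v w
    simp only [T, add_apply, diagForm_apply, mul_comm]
  have hT0 : ∀ f, T f (EuclideanSpace.single i₀ 1) (EuclideanSpace.single i₀ 1) = p f := by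
    intro f
    simp [T, add_apply, diagForm_apply, hi.symm]
  have hTA : ∀ f, matrixContraction A (T f)
      = matrixContraction A (fderiv ℝ (fderiv ℝ (P f)) 0) - f 0 := by
    intro f
    simp only [T, map_add, matrixContraction_diagForm, r, smul_smul, mul_inv_cancel₀ hA1.ne',
      one_smul]
    abel
  let Q (f : Euc n → F) (x : Euc n) : F := P f 0 + fderiv ℝ (P f) 0 x + quadraticMap (T f) x
  have hQ1 : ∀ f x, HasFDerivAt (Q f) (fderiv ℝ (P f) 0 + T f x) x := fun f x =>
    ((fderiv ℝ (P f) 0).hasFDerivAt.const_add _).add (hasFDerivAt_quadraticMap (hTsymm f) x)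
  have hQ1' : ∀ f, fderiv ℝ (Q f) = fun x => fderiv ℝ (P f) 0 + T f x := fun f =>
    funext fun x => (hQ1 f x).fderiv
  have hQ2 : ∀ f x, fderiv ℝ (fderiv ℝ (Q f)) x = T f := by
    intro f x
    rw [hQ1']
    exact ((T f).hasFDerivAt.const_add _).fderiv
  have hQc : ∀ f, ContDiff ℝ 2 (Q f) := fun f =>
    (contDiff_const.add (fderiv ℝ (P f) 0).contDiff).add (contDiff_quadraticMap _)
  set K : ℝ := ∑ i, ∑ j, |A i j|
  set C' : ℝ := C + (C + |(A i₁ i₁)⁻¹| * (K * C + 1 + |A i₀ i₀| * C)) with hC'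
  have hK : 0 ≤ K := Finset.sum_nonneg fun i _ => Finset.sum_nonneg fun j _ => abs_nonneg _
  have hC'0 : 0 ≤ C' := by positivity
  have hp : ∀ f M, HolderBounded α univ M f → ‖p f‖ ≤ C * M := by
    intro f M hf
    have h1 := (hP f M hf).2.1.1 0 (mem_univ _)
    refine (ContinuousLinearMap.le_opNorm₂ _ _ _).trans ?_
    simpa using h1
  have hTn : ∀ f M, HolderBounded α univ M f →
      ‖T f‖ ≤ (C + |(A i₁ i₁)⁻¹| * (K * C + 1 + |A i₀ i₀| * C)) * M := by
    intro f M hf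
    have h1 := (hP f M hf).2.1.1 0 (mem_univ _)
    have h2 : ‖r f‖ ≤ |(A i₁ i₁)⁻¹| * (K * (C * M) + M + |A i₀ i₀| * (C * M)) := by
      rw [norm_smul, Real.norm_eq_abs]
      gcongr
      refine (norm_sub_le _ _).trans (add_le_add ((norm_sub_le _ _).trans (add_le_add ?_ ?_)) ?_)
      · exact (norm_matrixContraction_le _ _).trans (by gcongr)
      · exact hf.1 0 (mem_univ _)
      · rw [norm_smul, Real.norm_eq_abs]
        gcongr
        exact hp f M hf
    calc _ ≤ ‖diagForm i₀ (p f)‖ + ‖diagForm i₁ (r f)‖ :=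
        ContinuousLinearMap.opNorm_add_le _ _
      _ ≤ C * M + |(A i₁ i₁)⁻¹| * (K * (C * M) + M + |A i₀ i₀| * (C * M)) :=
        add_le_add ((norm_diagForm_le _ _).trans (hp f M hf)) ((norm_diagForm_le _ _).trans h2)
      _ = _ := by ring
  refine ⟨C', fun f x => P f x - Q f x, hC'0, fun f g M N hf hg => ?_, fun f M hf => ?_⟩
  · have h0 := hPlin f g M N hf hg
    obtain ⟨h1, h2⟩ := fderiv_fderiv_sub (hP f M hf).1 (hP g N hg).1
    have hpp : p (fun x => f x - g x) = p f - p g := by simp [p, h0, h2]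
    have hrr : r (fun x => f x - g x) = r f - r g := by
      simp only [r, hpp, h0, h2, map_sub, ← smul_sub]
      congr 1
      rw [smul_sub]; abel
    funext x
    simp only [Q, quadraticMap, T, h0, h1, hpp, hrr, add_apply, diagForm_apply, sub_apply, smul_sub,
      smul_add]
    abel
  · have hM0 : 0 ≤ M := hf.nonneg (mem_univ 0)
    obtain ⟨hPc, hPH, hPE⟩ := hP f M hf
    obtain ⟨h1, h2⟩ := fderiv_fderiv_sub hPc (hQc f)
    have hc : ContDiff ℝ 2 fun x => P f x - Q f x := hPc.sub (hQc f)
    have hc1 : ContDiff ℝ 1 (fderiv ℝ fun x => P f x - Q f x) := hc.fderiv_right (by norm_num)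
    have hz0 : P f 0 - Q f 0 = 0 := by simp [Q, quadraticMap]
    have hz1 : fderiv ℝ (fun x => P f x - Q f x) 0 = 0 := by
      simp only [h1, hQ1', map_zero, add_zero, sub_self]
    have hH : HolderBounded α univ (C' * M) (fderiv ℝ (fderiv ℝ fun x => P f x - Q f x)) := by
      have hT : HolderBounded α univ ((C + |(A i₁ i₁)⁻¹| * (K * C + 1 + |A i₀ i₀| * C)) * M)
          fun _ : Euc n => T f :=
        .const (hTn f M hf)
      rw [h2]
      simp only [hQ2]
      exact (hPH.sub hT).mono (by rw [hC']; linarith) subset_rfl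
    have hb1 := norm_le_of_lipschitz_of_zero (by positivity) hz1 (lipschitz_of_norm_fderiv_le
      (hc1.differentiable one_ne_zero) fun x _ => hH.1 x (mem_univ x))
    have hb0 := norm_le_of_lipschitz_of_zero (by positivity) hz0 (lipschitz_of_norm_fderiv_le
      (hc.differentiable two_ne_zero) hb1)
    refine ⟨hc, hz0, hz1, ?_, hb0, hb1, hH, ?_⟩
    · rw [h2]
      simp only [hQ2, sub_apply, hT0]
      exact sub_self _
    -- The correction has constant Hessian, so it shifts the error by a constant. The new error
    -- vanishes at `0`, and its Lipschitz constant `δ / 2 * M` therefore bounds its sup norm too;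
    -- passing to exponent `α` on the unit ball costs the factor `2`.
    · have e : ∀ x, f x - matrixContraction A (fderiv ℝ (fderiv ℝ fun x => P f x - Q f x) x)
          = -((matrixContraction A (fderiv ℝ (fderiv ℝ (P f)) x) - f x)
            - (matrixContraction A (fderiv ℝ (fderiv ℝ (P f)) 0) - f 0)) := by
        intro x
        rw [h2]
        simp only [hQ2, map_sub, hTA]
        abel
      have hL : ∀ x ∈ closedBall (0 : Euc n) 1, ∀ y ∈ closedBall (0 : Euc n) 1,
          ‖(f x - matrixContraction A (fderiv ℝ (fderiv ℝ fun x => P f x - Q f x) x))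
            - (f y - matrixContraction A (fderiv ℝ (fderiv ℝ fun x => P f x - Q f x) y))‖
          ≤ δ / 2 * M * ‖x - y‖ := by
        intro x _ y _
        rw [e, e, neg_sub_neg, sub_sub_sub_cancel_right, norm_sub_rev]
        exact hPE x y
      have h3 := HolderBounded.of_lipschitz hα hα1 (by positivity)
        (norm_le_of_lipschitz_of_zero (by positivity) (by rw [e, sub_self, neg_zero]) hL)
        (by nlinarith [mul_nonneg hδ.le hM0]) hL
      exact h3.mono (by linarith) subset_rfl

end Normalization

/-! ### Composition operators in Hölder norms -/

section Nemytskii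

variable {E V W : Type*} [NormedAddCommGroup E] [NormedAddCommGroup V] [NormedSpace ℝ V]
  [NormedAddCommGroup W] [NormedSpace ℝ W]

/-- `f` is differentiable at the points of `K`, its derivative being bounded and Hölder continuous
on `K`. -/
def C1HolderBounded (α : ℝ) (K : Set V) (M : ℝ) (f : V → W) : Prop :=
  (∀ z ∈ K, DifferentiableAt ℝ f z) ∧ HolderBounded α K M (fderiv ℝ f)

variable {α M : ℝ} {K : Set V} {f : V → W}

theorem C1HolderBounded.norm_sub_le (hf : C1HolderBounded α K M f) (hK : Convex ℝ K) {a b : V}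
    (ha : a ∈ K) (hb : b ∈ K) : ‖f a - f b‖ ≤ M * ‖a - b‖ :=
  hK.norm_image_sub_le_of_norm_fderiv_le (𝕜 := ℝ) hf.1 hf.2.1 hb ha

/-- Move along the segments from `b` to `a` and from `b'` to `a'` simultaneously. The derivative of
the difference is `Df(p') ((a - b) - (a' - b')) + (Df(p) - Df(p')) (a - b)`, and the second term is
where Hölder continuity of `Df` enters. -/
theorem C1HolderBounded.norm_sub_sub_sub_le (hf : C1HolderBounded α K M f) (hα : 0 ≤ α)
    (hM : 0 ≤ M) (hK : Convex ℝ K) {a b a' b' : V} (ha : a ∈ K) (hb : b ∈ K) (ha' : a' ∈ K)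
    (hb' : b' ∈ K) {d : ℝ} (had : ‖a - a'‖ ≤ d) (hbd : ‖b - b'‖ ≤ d) :
    ‖(f a - f b) - (f a' - f b')‖ ≤ M * ‖(a - b) - (a' - b')‖ + M * d ^ α * ‖a - b‖ := by
  have hγ : ∀ {p q : V}, p ∈ K → q ∈ K → ∀ t ∈ Icc (0 : ℝ) 1, q + t • (p - q) ∈ K := by
    intro p q hp hq t ht
    exact hK.add_smul_sub_mem hq hp ht
  have hd : ∀ {p q : V}, p ∈ K → q ∈ K → ∀ t ∈ Icc (0 : ℝ) 1,
      HasDerivAt (fun t : ℝ => f (q + t • (p - q))) (fderiv ℝ f (q + t • (p - q)) (p - q)) t := by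
    intro p q hp hq t ht
    have h1 : HasDerivAt (fun t : ℝ => q + t • (p - q)) (p - q) t := by
      simpa using ((hasDerivAt_id t).smul_const (p - q)).const_add q
    exact (hf.1 _ (hγ hp hq t ht)).hasFDerivAt.comp_hasDerivAt t h1
  have h := norm_image_sub_le_of_norm_deriv_le_segment_01'
    (f := fun t : ℝ => f (b + t • (a - b)) - f (b' + t • (a' - b')))
    (C := M * ‖(a - b) - (a' - b')‖ + M * d ^ α * ‖a - b‖)
    (fun t ht => ((hd ha hb t ht).sub (hd ha' hb' t ht)).hasDerivWithinAt) fun t ht => ?_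
  · simpa [sub_sub_sub_comm, sub_right_comm] using h
  · have ht' : t ∈ Icc (0 : ℝ) 1 := ⟨ht.1, ht.2.le⟩
    set p := b + t • (a - b)
    set p' := b' + t • (a' - b')
    have e : fderiv ℝ f p (a - b) - fderiv ℝ f p' (a' - b')
        = fderiv ℝ f p' ((a - b) - (a' - b')) + (fderiv ℝ f p - fderiv ℝ f p') (a - b) := by
      simp only [map_sub, sub_apply]; abel
    have hpp : ‖p - p'‖ ≤ d := by
      have : p - p' = (1 - t) • (b - b') + t • (a - a') := by
        simp only [p, p']; module
      rw [this]
      refine (norm_add_le _ _).trans ?_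
      rw [norm_smul, norm_smul, Real.norm_of_nonneg ht'.1, Real.norm_of_nonneg (by linarith [ht.2])]
      nlinarith [ht.1, ht.2]
    rw [e]
    refine (norm_add_le _ _).trans (add_le_add ?_ ?_)
    · exact (ContinuousLinearMap.le_opNorm _ _).trans
        (by gcongr; exact hf.2.1 _ (hγ ha' hb' t ht'))
    · refine (ContinuousLinearMap.le_opNorm _ _).trans ?_
      gcongr
      exact (hf.2.2 _ (hγ ha hb t ht') _ (hγ ha' hb' t ht')).trans (by gcongr)

/-- Lipschitz dependence of the composition `f ∘ z` on `z` in the Hölder norm. -/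
theorem C1HolderBounded.comp_sub_comp (hf : C1HolderBounded α K M f) (hα : 0 < α) (hα1 : α < 1)
    (hM : 0 ≤ M) (hK : Convex ℝ K) {z₁ z₂ : E → V} {c D : ℝ} (hc : 0 ≤ c)
    (hz₁ : ∀ y ∈ closedBall (0 : E) 1, z₁ y ∈ K) (hz₂ : ∀ y ∈ closedBall (0 : E) 1, z₂ y ∈ K)
    (hl₁ : ∀ x ∈ closedBall (0 : E) 1, ∀ y ∈ closedBall (0 : E) 1, ‖z₁ x - z₁ y‖ ≤ c * ‖x - y‖)
    (hl₂ : ∀ x ∈ closedBall (0 : E) 1, ∀ y ∈ closedBall (0 : E) 1, ‖z₂ x - z₂ y‖ ≤ c * ‖x - y‖)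
    (hD : ∀ y ∈ closedBall (0 : E) 1, ‖z₁ y - z₂ y‖ ≤ D)
    (hDl : ∀ x ∈ closedBall (0 : E) 1, ∀ y ∈ closedBall (0 : E) 1,
      ‖(z₁ x - z₂ x) - (z₁ y - z₂ y)‖ ≤ D * ‖x - y‖) :
    HolderBounded α (closedBall 0 1) (M * (2 + c ^ α) * D) fun y => f (z₁ y) - f (z₂ y) := by
  have hD0 : 0 ≤ D := (norm_nonneg _).trans (hD 0 (by simp))
  have hcα : 0 ≤ c ^ α := Real.rpow_nonneg hc _
  refine ⟨fun y hy => ?_, fun x hx y hy => ?_⟩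
  · calc _ ≤ M * ‖z₁ y - z₂ y‖ := hf.norm_sub_le hK (hz₁ y hy) (hz₂ y hy)
      _ ≤ M * 1 * D := by rw [mul_one]; gcongr; exact hD y hy
      _ ≤ _ := by gcongr; linarith
  · have h2 := norm_sub_le_two_mul_rpow hα hα1 hx hy
    calc _ ≤ M * ‖(z₁ x - z₂ x) - (z₁ y - z₂ y)‖ + M * (c * ‖x - y‖) ^ α * ‖z₁ x - z₂ x‖ :=
          hf.norm_sub_sub_sub_le hα.le hM hK (hz₁ x hx) (hz₂ x hx) (hz₁ y hy) (hz₂ y hy)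
            (hl₁ x hx y hy) (hl₂ x hx y hy)
      _ ≤ M * (D * (2 * ‖x - y‖ ^ α)) + M * (c ^ α * ‖x - y‖ ^ α) * D := by
          rw [Real.mul_rpow hc (norm_nonneg _)]
          gcongr
          · exact (hDl x hx y hy).trans (by gcongr)
          · exact hD x hx
      _ = _ := by ring

theorem HolderBounded.smul {g : E → ℝ} {h : E → W} {s : Set E} {N : ℝ} (hN : 0 ≤ N)
    (hg : HolderBounded α s M g) (hh : HolderBounded α s N h) :
    HolderBounded α s (2 * M * N) fun x => g x • h x := by
  refine ⟨fun x hx => ?_, fun x hx y hy => ?_⟩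
  · have hM := hg.nonneg hx
    rw [norm_smul]
    calc _ ≤ M * N := by gcongr; exacts [hg.1 x hx, hh.1 x hx]
      _ ≤ _ := by nlinarith [mul_nonneg hM hN]
  · have hM := hg.nonneg hx
    have e : g x • h x - g y • h y = (g x - g y) • h x + g y • (h x - h y) := by module
    rw [e]
    refine (norm_add_le _ _).trans ?_
    rw [norm_smul, norm_smul]
    calc _ ≤ (M * ‖x - y‖ ^ α) * N + M * (N * ‖x - y‖ ^ α) := by
          gcongr
          exacts [hg.2 x hx y hy, hh.1 x hx, hg.1 y hy, hh.2 x hx y hy]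
      _ = _ := by ring

end Nemytskii

/-! ### Contraction principle -/

section FixedPoint

variable {E F : Type*} [NormedAddCommGroup E] [NormedAddCommGroup F] {α M : ℝ}

theorem HolderBounded.sum {ι : Type*} {s : Set E} (I : Finset ι) {N : ι → ℝ} {h : ι → E → F}
    (hh : ∀ i ∈ I, HolderBounded α s (N i) (h i)) :
    HolderBounded α s (∑ i ∈ I, N i) fun x => ∑ i ∈ I, h i x := by
  refine ⟨fun x hx => norm_sum_le_of_le _ fun i hi => (hh i hi).1 x hx, fun x hx y hy => ?_⟩
  rw [← Finset.sum_sub_distrib, Finset.sum_mul]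
  exact norm_sum_le_of_le _ fun i hi => (hh i hi).2 x hx y hy

theorem HolderBounded.of_tendsto {f : ℕ → E → F} {g : E → F} {s : Set E}
    (hf : ∀ k, HolderBounded α s M (f k)) (hg : ∀ x, Tendsto (fun k => f k x) atTop (𝓝 (g x))) :
    HolderBounded α s M g :=
  ⟨fun x hx => le_of_tendsto (hg x).norm (Eventually.of_forall fun k => (hf k).1 x hx),
    fun x hx y hy => le_of_tendsto ((hg x).sub (hg y)).norm
      (Eventually.of_forall fun k => (hf k).2 x hx y hy)⟩

/-- The contraction principle for the Hölder norm. -/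
theorem exists_fixedPoint_of_holderBounded [CompleteSpace F] (hM : 0 ≤ M) (T : (E → F) → E → F)
    (hT : ∀ f, HolderBounded α univ M f → HolderBounded α univ M (T f))
    (hTc : ∀ f g δ, HolderBounded α univ M f → HolderBounded α univ M g →
      HolderBounded α univ δ (fun x => f x - g x) →
      HolderBounded α univ (δ / 2) fun x => T f x - T g x) :
    ∃ f, HolderBounded α univ M f ∧ T f = f := by
  -- The iteration starts from `0`. Limits are taken pointwise only: Hölder bounds survive them, so
  -- no Banach space of Hölder functions is needed.
  let f : ℕ → E → F := fun k => T^[k] fun _ => 0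
  have hsucc : ∀ k, f (k + 1) = T (f k) := fun k => Function.iterate_succ_apply' T k _
  have hf : ∀ k, HolderBounded α univ M (f k) := by
    intro k
    induction k with
    | zero => exact HolderBounded.const (c := (0 : F)) (by rw [norm_zero]; exact hM)
    | succ k ih => rw [hsucc]; exact hT _ ih
  have hstep : ∀ k, HolderBounded α univ (2 * M / 2 ^ k) fun x => f (k + 1) x - f k x := by
    intro k
    induction k with
    | zero => exact ((hf 1).sub (hf 0)).mono (by simp [two_mul]) subset_rfl
    | succ k ih =>
      have h := hTc _ _ _ (hf (k + 1)) (hf k) ih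
      rw [← hsucc, ← hsucc] at h
      exact h.mono (by rw [pow_succ, div_div]) subset_rfl
  -- Keeping the exact geometric partial sum, rather than its bound `4 M / 2 ^ k`, is what closes
  -- the induction on `j`.
  have hsum : ∀ k j, HolderBounded α univ (4 * M / 2 ^ k - 4 * M / 2 ^ (k + j))
      fun x => f (k + j) x - f k x := by
    intro k j
    induction j with
    | zero => simpa using (HolderBounded.const (c := (0 : F)) (E := E) (by simp) :
        HolderBounded α univ 0 fun _ => (0 : F))
    | succ j ih =>
      refine (((hstep (k + j)).add ih).congr (g := fun x => f (k + (j + 1)) x - f k x)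
        fun x _ => ?_).mono ?_ subset_rfl
      · rw [sub_add_sub_cancel]; rfl
      · rw [← add_assoc, pow_succ 2 (k + j)]
        have : (0 : ℝ) < 2 ^ (k + j) := by positivity
        apply le_of_eq; field_simp; ring
  have hlim : ∀ x, ∃ y, Tendsto (fun k => f k x) atTop (𝓝 y) := by
    intro x
    refine cauchySeq_tendsto_of_complete (cauchySeq_of_le_geometric_two (C := 4 * M) fun k => ?_)
    rw [dist_comm, dist_eq_norm]
    refine ((hstep k).1 x (mem_univ _)).trans (le_of_eq ?_)
    ring
  choose g hg using hlim
  have hgM : HolderBounded α univ M g := .of_tendsto hf hg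
  have hclose : ∀ k, HolderBounded α univ (4 * M / 2 ^ k) fun x => g x - f k x := by
    intro k
    refine .of_tendsto (f := fun j x => f (k + j) x - f k x)
      (fun j => (hsum k j).mono ?_ subset_rfl) fun x => ?_
    · have : 0 ≤ 4 * M / 2 ^ (k + j) := by positivity
      linarith
    · have := (tendsto_add_atTop_iff_nat k).2 (hg x)
      simp only [add_comm _ k] at this
      exact this.sub_const _
  refine ⟨g, hgM, funext fun x => ?_⟩
  refine tendsto_nhds_unique (f := fun k => f (k + 1) x) ?_
    ((tendsto_add_atTop_iff_nat 1).2 (hg x))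
  rw [tendsto_iff_norm_sub_tendsto_zero]
  refine squeeze_zero (g := fun k : ℕ => 2 * M * (1 / 2) ^ k) (fun _ => norm_nonneg _)
    (fun k => ?_) ?_
  · have h := (hTc _ _ _ hgM (hf k) (hclose k)).1 x (mem_univ _)
    rw [hsucc, norm_sub_rev]
    refine h.trans (le_of_eq ?_)
    rw [one_div, inv_pow]; ring
  · simpa using (tendsto_pow_atTop_nhds_zero_of_lt_one (r := (1 / 2 : ℝ)) (by norm_num)
      (by norm_num)).const_mul (2 * M)

end FixedPoint

/-! ### The nonlinearity at scale `ρ` as a small perturbation -/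

section Perturbation

variable {n m : ℕ}

/-- `w` is of class `C^2`, with Hölder second derivative, and `M` bounds its norm on the unit
ball. -/
structure C2HolderBounded (α M : ℝ) (w : Euc n → Euc m) : Prop where
  contDiff : ContDiff ℝ 2 w
  norm_le : ∀ x ∈ closedBall (0 : Euc n) 1, ‖w x‖ ≤ M
  norm_fderiv_le : ∀ x ∈ closedBall (0 : Euc n) 1, ‖fderiv ℝ w x‖ ≤ M
  holder : HolderBounded α (closedBall 0 1) M (fderiv ℝ (fderiv ℝ w))

variable {α M N : ℝ} {w v : Euc n → Euc m}

theorem C2HolderBounded.nonneg (hw : C2HolderBounded α M w) : 0 ≤ M :=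
  (norm_nonneg _).trans (hw.norm_le 0 (by simp))

theorem fderiv_fderiv_add (hw : ContDiff ℝ 2 w) (hv : ContDiff ℝ 2 v) :
    (fderiv ℝ fun x => w x + v x) = (fun x => fderiv ℝ w x + fderiv ℝ v x) ∧
    (fderiv ℝ (fderiv ℝ fun x => w x + v x)) =
      fun x => fderiv ℝ (fderiv ℝ w) x + fderiv ℝ (fderiv ℝ v) x := by
  have h1 : (fderiv ℝ fun x => w x + v x) = fun x => fderiv ℝ w x + fderiv ℝ v x :=
    funext fun x => fderiv_fun_add (hw.differentiable two_ne_zero x)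
      (hv.differentiable two_ne_zero x)
  refine ⟨h1, ?_⟩
  rw [h1]
  exact funext fun x => fderiv_fun_add
    ((hw.fderiv_right (m := 1) (by norm_num)).differentiable one_ne_zero x)
    ((hv.fderiv_right (m := 1) (by norm_num)).differentiable one_ne_zero x)

theorem C2HolderBounded.add (hw : C2HolderBounded α M w) (hv : C2HolderBounded α N v) :
    C2HolderBounded α (M + N) fun x => w x + v x := by
  obtain ⟨h1, h2⟩ := fderiv_fderiv_add hw.contDiff hv.contDiff
  refine ⟨hw.contDiff.add hv.contDiff,
    fun x hx => (norm_add_le _ _).trans (add_le_add (hw.norm_le x hx) (hv.norm_le x hx)), ?_, ?_⟩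
  · intro x hx
    rw [h1]
    exact (norm_add_le _ _).trans (add_le_add (hw.norm_fderiv_le x hx) (hv.norm_fderiv_le x hx))
  · rw [h2]
    exact hw.holder.add hv.holder

theorem C2HolderBounded.lipschitz (hw : C2HolderBounded α M w) :
    ∀ x ∈ closedBall (0 : Euc n) 1, ∀ y ∈ closedBall (0 : Euc n) 1,
      ‖w x - w y‖ ≤ M * ‖x - y‖ :=
  lipschitz_of_norm_fderiv_le (hw.contDiff.differentiable two_ne_zero) hw.norm_fderiv_le

theorem C2HolderBounded.lipschitz_fderiv (hw : C2HolderBounded α M w) :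
    ∀ x ∈ closedBall (0 : Euc n) 1, ∀ y ∈ closedBall (0 : Euc n) 1,
      ‖fderiv ℝ w x - fderiv ℝ w y‖ ≤ M * ‖x - y‖ :=
  lipschitz_of_norm_fderiv_le
    ((hw.contDiff.fderiv_right (m := 1) (by norm_num)).differentiable one_ne_zero) hw.holder.1

/-- The 1-jet at `ρ y` of `x ↦ c₀ + c₁ x + ρ² w (x / ρ)`. -/
noncomputable def rescaledJet (c₀ : Euc m) (c₁ : Euc n →L[ℝ] Euc m) (ρ : ℝ) (w : Euc n → Euc m)
    (y : Euc n) : Jet n m :=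
  (ρ • y, c₀ + ρ • c₁ y + ρ ^ 2 • w y, c₁ + ρ • fderiv ℝ w y)

variable {c₀ : Euc m} {c₁ : Euc n →L[ℝ] Euc m} {ρ : ℝ}

theorem norm_jet_le {z : Jet n m} {r : ℝ} (h1 : ‖z.1‖ ≤ r) (h2 : ‖z.2.1‖ ≤ r) (h3 : ‖z.2.2‖ ≤ r) :
    ‖z‖ ≤ r := by
  rw [Prod.norm_def, Prod.norm_def]
  exact max_le h1 (max_le h2 h3)

theorem norm_smul_add_sq_smul_le {V : Type*} [NormedAddCommGroup V] [NormedSpace ℝ V] {p q : V}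
    {a b : ℝ} (hρ : 0 ≤ ρ) (hρ1 : ρ ≤ 1) (hp : ‖p‖ ≤ a) (hq : ‖q‖ ≤ b) :
    ‖ρ • p + ρ ^ 2 • q‖ ≤ ρ * (a + b) := by
  have hb : 0 ≤ b := (norm_nonneg _).trans hq
  refine (norm_add_le _ _).trans ?_
  rw [norm_smul, norm_smul, norm_pow, Real.norm_of_nonneg hρ, mul_add]
  have : ρ ^ 2 ≤ ρ := by nlinarith
  gcongr

theorem norm_rescaledJet_sub_le (hρ : 0 ≤ ρ) (hρ1 : ρ ≤ 1) (hw : C2HolderBounded α M w) :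
    ∀ y ∈ closedBall (0 : Euc n) 1,
      ‖rescaledJet c₀ c₁ ρ w y - (0, c₀, c₁)‖ ≤ ρ * (1 + ‖c₁‖ + M) := by
  intro y hy
  have hM := hw.nonneg
  have h0 := hw.norm_le y hy
  have h1 := hw.norm_fderiv_le y hy
  rw [mem_closedBall_zero_iff] at hy
  have hc := norm_nonneg c₁
  refine norm_jet_le ?_ ?_ ?_
  · simp only [rescaledJet, Prod.fst_sub, sub_zero, norm_smul, Real.norm_of_nonneg hρ]
    gcongr; linarith
  · simp only [rescaledJet, Prod.fst_sub, Prod.snd_sub, add_assoc, add_sub_cancel_left]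
    exact (norm_smul_add_sq_smul_le hρ hρ1 ((c₁.le_opNorm_of_le hy).trans_eq (mul_one _)) h0).trans
      (mul_le_mul_of_nonneg_left (by linarith) hρ)
  · simp only [rescaledJet, Prod.snd_sub, add_sub_cancel_left, norm_smul, Real.norm_of_nonneg hρ]
    gcongr; linarith

theorem norm_rescaledJet_sub_rescaledJet_le (hρ : 0 ≤ ρ) (hρ1 : ρ ≤ 1)
    (hw : C2HolderBounded α M w) :
    ∀ x ∈ closedBall (0 : Euc n) 1, ∀ y ∈ closedBall (0 : Euc n) 1,
      ‖rescaledJet c₀ c₁ ρ w x - rescaledJet c₀ c₁ ρ w y‖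
        ≤ ρ * (1 + ‖c₁‖ + M) * ‖x - y‖ := by
  intro x hx y hy
  have hM := hw.nonneg
  have h0 := hw.lipschitz x hx y hy
  have h1 := hw.lipschitz_fderiv x hx y hy
  have hc := norm_nonneg c₁
  have hxy := norm_nonneg (x - y)
  refine norm_jet_le ?_ ?_ ?_
  · simp only [rescaledJet, Prod.fst_sub, ← smul_sub, norm_smul, Real.norm_of_nonneg hρ]
    nlinarith [mul_nonneg hρ hxy, mul_nonneg (mul_nonneg hρ hxy) (add_nonneg hc hM)]
  · have e : (rescaledJet c₀ c₁ ρ w x - rescaledJet c₀ c₁ ρ w y).2.1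
        = ρ • c₁ (x - y) + ρ ^ 2 • (w x - w y) := by
      simp only [rescaledJet, Prod.fst_sub, Prod.snd_sub, map_sub, smul_sub]
      abel
    rw [e]
    refine (norm_smul_add_sq_smul_le hρ hρ1 (c₁.le_opNorm _) h0).trans ?_
    nlinarith [mul_nonneg hρ hxy]
  · have e : (rescaledJet c₀ c₁ ρ w x - rescaledJet c₀ c₁ ρ w y).2.2
        = ρ • (fderiv ℝ w x - fderiv ℝ w y) := by
      simp only [rescaledJet, Prod.snd_sub, smul_sub]
      abel
    rw [e, norm_smul, Real.norm_of_nonneg hρ]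
    calc _ ≤ ρ * (M * ‖x - y‖) := by gcongr
      _ ≤ _ := by rw [mul_assoc]; gcongr; linarith

theorem rescaledJet_sub_rescaledJet (hw : ContDiff ℝ 2 w) (hv : ContDiff ℝ 2 v) (y : Euc n) :
    rescaledJet c₀ c₁ ρ w y - rescaledJet c₀ c₁ ρ v y
      = (0, ρ ^ 2 • (w y - v y), ρ • fderiv ℝ (fun x => w x - v x) y) := by
  rw [(fderiv_fderiv_sub hw hv).1]
  simp only [rescaledJet, Prod.mk_sub_mk, sub_self, smul_sub, add_sub_add_left_eq_sub]

/-- The base point and the affine part cancel, leaving an expression linear in `w - v` with a factor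
`ρ`. -/
theorem norm_rescaledJet_sub_of_sub (hρ : 0 ≤ ρ) (hρ1 : ρ ≤ 1) (hw : ContDiff ℝ 2 w)
    (hv : ContDiff ℝ 2 v) (hwv : C2HolderBounded α N fun x => w x - v x) :
    (∀ y ∈ closedBall (0 : Euc n) 1,
      ‖rescaledJet c₀ c₁ ρ w y - rescaledJet c₀ c₁ ρ v y‖ ≤ ρ * N) ∧
    ∀ x ∈ closedBall (0 : Euc n) 1, ∀ y ∈ closedBall (0 : Euc n) 1,
      ‖(rescaledJet c₀ c₁ ρ w x - rescaledJet c₀ c₁ ρ v x)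
        - (rescaledJet c₀ c₁ ρ w y - rescaledJet c₀ c₁ ρ v y)‖ ≤ ρ * N * ‖x - y‖ := by
  have hN := hwv.nonneg
  have hsq : ρ ^ 2 ≤ ρ := by nlinarith
  refine ⟨fun y hy => ?_, fun x hx y hy => ?_⟩
  · rw [rescaledJet_sub_rescaledJet hw hv]
    refine norm_jet_le ?_ ?_ ?_
    · simp only [norm_zero]; positivity
    · simp only [norm_smul, norm_pow, Real.norm_of_nonneg hρ]
      gcongr
      exact hwv.norm_le y hy
    · simp only [norm_smul, Real.norm_of_nonneg hρ]
      gcongr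
      exact hwv.norm_fderiv_le y hy
  · rw [rescaledJet_sub_rescaledJet hw hv, rescaledJet_sub_rescaledJet hw hv]
    simp only [Prod.mk_sub_mk, sub_self, ← smul_sub, mul_assoc]
    refine norm_jet_le ?_ ?_ ?_
    · simp only [norm_zero]; positivity
    · simp only [norm_smul, norm_pow, Real.norm_of_nonneg hρ]
      gcongr
      exact hwv.lipschitz x hx y hy
    · have e : ρ • fderiv ℝ (fun x => w x - v x) x - ρ • fderiv ℝ (fun x => w x - v x) y
          = ρ • (fderiv ℝ (fun x => w x - v x) x - fderiv ℝ (fun x => w x - v x) y) := by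
        rw [smul_sub]
      refine (congrArg norm e).trans_le ?_
      rw [norm_smul, Real.norm_of_nonneg hρ]
      gcongr
      exact hwv.lipschitz_fderiv x hx y hy

/-- Composition with the rescaled jet: distance to the value at the base point and Lipschitz
dependence on `w`. -/
theorem C1HolderBounded.comp_rescaledJet {W : Type*} [NormedAddCommGroup W] [NormedSpace ℝ W]
    {f : Jet n m → W} {r L : ℝ} (hα : 0 < α) (hα1 : α < 1)
    (hf : C1HolderBounded α (closedBall (0, c₀, c₁) r) L f) (hM : 0 ≤ M) (hr : 0 < r) :
    ∃ B, 0 ≤ B ∧ ∀ ρ, 0 ≤ ρ → ρ ≤ 1 → ρ * (1 + ‖c₁‖ + M) ≤ r →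
      (∀ w, C2HolderBounded α M w → HolderBounded α (closedBall 0 1) (ρ * B)
        fun y => f (rescaledJet c₀ c₁ ρ w y) - f (0, c₀, c₁)) ∧
      ∀ w v N, C2HolderBounded α M w → C2HolderBounded α M v →
        C2HolderBounded α N (fun x => w x - v x) →
        HolderBounded α (closedBall 0 1) (ρ * B * N)
          fun y => f (rescaledJet c₀ c₁ ρ w y) - f (rescaledJet c₀ c₁ ρ v y) := by
  set c := 1 + ‖c₁‖ + M with hc
  have hc0 : 0 < c := by positivity
  have hz : ((0, c₀, c₁) : Jet n m) ∈ closedBall (0, c₀, c₁) r := mem_closedBall_self hr.le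
  have hL : 0 ≤ L := hf.2.nonneg hz
  have hcα : 0 ≤ c ^ α := Real.rpow_nonneg hc0.le _
  have hK := convex_closedBall ((0, c₀, c₁) : Jet n m) r
  -- The factor `c + 1` covers both applications below: distance `ρ c` from the constant jet at the
  -- base point, and distance `ρ N` between two jets.
  refine ⟨L * (2 + c ^ α) * (c + 1), by positivity, fun ρ hρ hρ1 hρr => ?_⟩
  have hmem : ∀ w, C2HolderBounded α M w → ∀ y ∈ closedBall (0 : Euc n) 1,
      rescaledJet c₀ c₁ ρ w y ∈ closedBall ((0, c₀, c₁) : Jet n m) r := by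
    intro w hw y hy
    rw [mem_closedBall, dist_eq_norm]
    exact (norm_rescaledJet_sub_le hρ hρ1 hw y hy).trans hρr
  have hlip : ∀ w, C2HolderBounded α M w → ∀ x ∈ closedBall (0 : Euc n) 1,
      ∀ y ∈ closedBall (0 : Euc n) 1,
      ‖rescaledJet c₀ c₁ ρ w x - rescaledJet c₀ c₁ ρ w y‖ ≤ c * ‖x - y‖ := by
    intro w hw x hx y hy
    refine (norm_rescaledJet_sub_rescaledJet_le hρ hρ1 hw x hx y hy).trans ?_
    gcongr
    exact mul_le_of_le_one_left hc0.le hρ1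
  refine ⟨fun w hw => ?_, fun w v N hw hv hwv => ?_⟩
  · refine (hf.comp_sub_comp (z₂ := fun _ => (0, c₀, c₁)) (D := ρ * c) hα hα1 hL hK hc0.le
      (hmem w hw) (fun _ _ => hz) (hlip w hw) (fun x _ y _ => ?_)
      (norm_rescaledJet_sub_le hρ hρ1 hw) fun x hx y hy => ?_).mono ?_ subset_rfl
    · rw [sub_self, norm_zero]; positivity
    · rw [sub_sub_sub_cancel_right]
      exact norm_rescaledJet_sub_rescaledJet_le hρ hρ1 hw x hx y hy
    · calc L * (2 + c ^ α) * (ρ * c) = ρ * (L * (2 + c ^ α) * c) := by ring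
        _ ≤ _ := by gcongr; linarith
  · have hN := hwv.nonneg
    obtain ⟨h1, h2⟩ := norm_rescaledJet_sub_of_sub (c₀ := c₀) (c₁ := c₁) hρ hρ1 hw.contDiff
      hv.contDiff hwv
    refine (hf.comp_sub_comp hα hα1 hL hK hc0.le (hmem w hw) (hmem v hv) (hlip w hw) (hlip v hv)
      h1 h2).mono ?_ subset_rfl
    calc L * (2 + c ^ α) * (ρ * N) = ρ * (L * (2 + c ^ α) * 1) * N := by ring
      _ ≤ _ := by gcongr; linarith

theorem HolderBounded.apply_single {s : Set (Euc n)} {T : Euc n → Euc n →L[ℝ] Euc n →L[ℝ] Euc m}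
    (hT : HolderBounded α s M T) (i j : Fin n) :
    HolderBounded α s M fun x => T x (EuclideanSpace.single i 1) (EuclideanSpace.single j 1) := by
  have h : ∀ S : Euc n →L[ℝ] Euc n →L[ℝ] Euc m,
      ‖S (EuclideanSpace.single i 1) (EuclideanSpace.single j 1)‖ ≤ ‖S‖ := fun S => by
    simpa using S.le_opNorm₂ (EuclideanSpace.single i 1) (EuclideanSpace.single j 1)
  refine ⟨fun x hx => (h _).trans (hT.1 x hx), fun x hx y hy => ?_⟩
  have := h (T x - T y)
  simp only [sub_apply] at this
  exact this.trans (hT.2 x hx y hy)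

/-- The difference between the right-hand side and the deviation of `L u` from the operator with
coefficients frozen at the base point, at unit scale. -/
noncomputable def perturbation (a : Fin n → Fin n → Jet n m → ℝ) (φ : Jet n m → Euc m) (c₀ : Euc m)
    (c₁ : Euc n →L[ℝ] Euc m) (ρ : ℝ) (w : Euc n → Euc m) (y : Euc n) : Euc m :=
  φ (rescaledJet c₀ c₁ ρ w y) - ∑ i, ∑ j,
    (a i j (rescaledJet c₀ c₁ ρ w y) - a i j (0, c₀, c₁)) •
      fderiv ℝ (fderiv ℝ w) y (EuclideanSpace.single i 1) (EuclideanSpace.single j 1)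

theorem exists_perturbation_bound {a : Fin n → Fin n → Jet n m → ℝ} {φ : Jet n m → Euc m}
    {r L : ℝ} (hα : 0 < α) (hα1 : α < 1) (hr : 0 < r)
    (ha : ∀ i j, C1HolderBounded α (closedBall (0, c₀, c₁) r) L (a i j))
    (hφ : C1HolderBounded α (closedBall (0, c₀, c₁) r) L φ) (hM : 0 ≤ M) :
    ∃ B, 0 ≤ B ∧ ∀ ρ, 0 ≤ ρ → ρ ≤ 1 → ρ * (1 + ‖c₁‖ + M) ≤ r →
      (∀ w, C2HolderBounded α M w → HolderBounded α (closedBall 0 1) (ρ * B)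
        fun y => perturbation a φ c₀ c₁ ρ w y - φ (0, c₀, c₁)) ∧
      ∀ w v N, C2HolderBounded α M w → C2HolderBounded α M v →
        C2HolderBounded α N (fun x => w x - v x) →
        HolderBounded α (closedBall 0 1) (ρ * B * N)
          fun y => perturbation a φ c₀ c₁ ρ w y - perturbation a φ c₀ c₁ ρ v y := by
  obtain ⟨B₀, hB₀, h₀⟩ := hφ.comp_rescaledJet hα hα1 hM hr
  choose B hB h using fun i j => (ha i j).comp_rescaledJet hα hα1 hM hr
  have hS : 0 ≤ ∑ i, ∑ j, B i j :=
    Finset.sum_nonneg fun i _ => Finset.sum_nonneg fun j _ => hB i j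
  refine ⟨B₀ + 2 * (M + 1) * ∑ i, ∑ j, B i j, by positivity, fun ρ hρ hρ1 hρr => ⟨fun w hw => ?_,
    fun w v N hw hv hwv => ?_⟩⟩
  · have h1 := ((h₀ ρ hρ hρ1 hρr).1 w hw).sub (HolderBounded.sum Finset.univ fun i _ =>
      HolderBounded.sum Finset.univ fun j _ =>
        ((h i j ρ hρ hρ1 hρr).1 w hw).smul hM (hw.holder.apply_single i j))
    refine (h1.congr fun y _ => ?_).mono ?_ subset_rfl
    · simp only [perturbation]; abel
    · have e : ∑ i, ∑ j, 2 * (ρ * B i j) * M = ρ * (2 * M * ∑ i, ∑ j, B i j) := by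
        simp only [Finset.mul_sum]
        exact Finset.sum_congr rfl fun i _ => Finset.sum_congr rfl fun j _ => by ring
      rw [e, ← mul_add]
      gcongr; linarith
  · have hN := hwv.nonneg
    -- The product difference is split as `(a(w) - a(v)) D²w + (a(v) - a(0, c₀, c₁)) D²(w - v)`;
    -- each term carries both `ρ` and `N`.
    have h1 := ((h₀ ρ hρ hρ1 hρr).2 w v N hw hv hwv).sub (HolderBounded.sum Finset.univ fun i _ =>
      HolderBounded.sum Finset.univ fun j _ =>
        (((h i j ρ hρ hρ1 hρr).2 w v N hw hv hwv).smul hM (hw.holder.apply_single i j)).add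
        (((h i j ρ hρ hρ1 hρr).1 v hv).smul hN (hwv.holder.apply_single i j)))
    refine (h1.congr fun y _ => ?_).mono ?_ subset_rfl
    · simp only [perturbation]
      rw [sub_sub_sub_comm, ← Finset.sum_sub_distrib]
      congr 1
      refine Finset.sum_congr rfl fun i _ => ?_
      rw [← Finset.sum_sub_distrib]
      refine Finset.sum_congr rfl fun j _ => ?_
      rw [(fderiv_fderiv_sub hw.contDiff hv.contDiff).2]
      simp only [sub_apply]
      module
    · have e : ∑ i, ∑ j, (2 * (ρ * B i j * N) * M + 2 * (ρ * B i j) * N)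
          = ρ * (2 * (M + 1) * ∑ i, ∑ j, B i j) * N := by
        simp only [Finset.mul_sum, Finset.sum_mul]
        exact Finset.sum_congr rfl fun i _ => Finset.sum_congr rfl fun j _ => by ring
      rw [e]
      apply le_of_eq; ring

end Perturbation

/-! ### Solving the rescaled system on the unit ball -/

section UnitScale

/-- The radial retraction of a normed space onto its closed unit ball. -/
noncomputable def unitRetraction {E : Type*} [NormedAddCommGroup E] [NormedSpace ℝ E] (x : E) : E :=
  (max 1 ‖x‖)⁻¹ • x

theorem unitRetraction_mem {E : Type*} [NormedAddCommGroup E] [NormedSpace ℝ E] (x : E) :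
    unitRetraction x ∈ closedBall (0 : E) 1 := by
  have h : 0 < max 1 ‖x‖ := lt_max_of_lt_left one_pos
  rw [mem_closedBall_zero_iff, unitRetraction, norm_smul, norm_inv, Real.norm_of_nonneg h.le,
    inv_mul_le_iff₀ h, mul_one]
  exact le_max_right _ _

theorem unitRetraction_of_mem {E : Type*} [NormedAddCommGroup E] [NormedSpace ℝ E] {x : E}
    (hx : x ∈ closedBall (0 : E) 1) : unitRetraction x = x := by
  rw [mem_closedBall_zero_iff] at hx
  rw [unitRetraction, max_eq_left hx, inv_one, one_smul]

/-- The retraction extends functions from the unit ball to the whole space, where the right inverse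
acts, at the cost of a factor `2` in the Hölder bound. -/
theorem norm_unitRetraction_sub_le {E : Type*} [NormedAddCommGroup E] [NormedSpace ℝ E] (x y : E) :
    ‖unitRetraction x - unitRetraction y‖ ≤ 2 * ‖x - y‖ := by
  set s := max 1 ‖x‖ with hs
  set t := max 1 ‖y‖ with ht
  have hs1 : 1 ≤ s := le_max_left _ _
  have ht1 : 1 ≤ t := le_max_left _ _
  have hs0 : 0 < s := by linarith
  have ht0 : 0 < t := by linarith
  have hst : |t - s| ≤ ‖x - y‖ := by
    rw [abs_sub_comm]
    exact (abs_max_sub_max_le_abs _ _ _).trans' (by rw [hs, ht, max_comm 1, max_comm 1])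
      |>.trans (abs_norm_sub_norm_le x y)
  have e : unitRetraction x - unitRetraction y = s⁻¹ • (x - y) + (s⁻¹ - t⁻¹) • y := by
    simp only [unitRetraction, ← hs, ← ht]; module
  have h1 : ‖s⁻¹ • (x - y)‖ ≤ ‖x - y‖ := by
    rw [norm_smul, norm_inv, Real.norm_of_nonneg hs0.le]
    exact mul_le_of_le_one_left (norm_nonneg _) (inv_le_one_of_one_le₀ hs1)
  have h2 : ‖(s⁻¹ - t⁻¹) • y‖ ≤ ‖x - y‖ := by
    rw [norm_smul, inv_sub_inv hs0.ne' ht0.ne', Real.norm_eq_abs, abs_div,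
      abs_of_pos (mul_pos hs0 ht0), div_mul_eq_mul_div, div_le_iff₀ (mul_pos hs0 ht0)]
    gcongr
    exact (le_max_right 1 ‖y‖).trans (le_mul_of_one_le_left ht0.le hs1)
  rw [e]
  linarith [norm_add_le (s⁻¹ • (x - y)) ((s⁻¹ - t⁻¹) • y)]

theorem HolderBounded.comp_unitRetraction {E F : Type*} [NormedAddCommGroup E] [NormedSpace ℝ E]
    [NormedAddCommGroup F] {α M : ℝ} {f : E → F} (hα : 0 < α) (hα1 : α < 1)
    (hf : HolderBounded α (closedBall 0 1) M f) :
    HolderBounded α univ (2 * M) fun x => f (unitRetraction x) := by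
  have hM := hf.nonneg (mem_closedBall_self zero_le_one)
  refine ⟨fun x _ => (hf.1 _ (unitRetraction_mem x)).trans (by linarith), fun x _ y _ => ?_⟩
  refine (hf.2 _ (unitRetraction_mem x) _ (unitRetraction_mem y)).trans ?_
  calc _ ≤ M * (2 * ‖x - y‖) ^ α := by gcongr; exact norm_unitRetraction_sub_le x y
    _ = M * (2 ^ α * ‖x - y‖ ^ α) := by rw [Real.mul_rpow zero_le_two (norm_nonneg _)]
    _ ≤ M * (2 ^ (1 : ℝ) * ‖x - y‖ ^ α) := by gcongr; norm_num
    _ = _ := by rw [Real.rpow_one]; ring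

variable {n m : ℕ} {α : ℝ}

/-- A quadratic map annihilated by `A : D²` with prescribed pure second derivative. -/
theorem exists_quadratic_kernel {i₀ i₁ : Fin n} (hi : i₀ ≠ i₁) {A : Fin n → Fin n → ℝ}
    (hA : A i₁ i₁ ≠ 0) :
    ∃ H : ℝ, 0 ≤ H ∧ ∀ p : Euc m, ‖p‖ ≤ 1 → ∃ h : Euc n → Euc m,
      C2HolderBounded α H h ∧ h 0 = 0 ∧ fderiv ℝ h 0 = 0 ∧
      fderiv ℝ (fderiv ℝ h) 0 (EuclideanSpace.single i₀ 1) (EuclideanSpace.single i₀ 1) = p ∧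
      ∀ y, matrixContraction A (fderiv ℝ (fderiv ℝ h) y) = 0 := by
  refine ⟨1 + |A i₀ i₀ / A i₁ i₁|, by positivity, fun p hp => ?_⟩
  -- The second diagonal entry cancels the contribution `A i₀ i₀ • p` to `A : T`.
  set T : Euc n →L[ℝ] Euc n →L[ℝ] Euc m :=
    diagForm i₀ p + diagForm i₁ (-(A i₀ i₀ / A i₁ i₁) • p) with hT
  have hTsymm : ∀ v w, T v w = T w v := fun v w => by
    simp only [hT, add_apply, diagForm_apply, mul_comm]
  have hTn : ‖T‖ ≤ 1 + |A i₀ i₀ / A i₁ i₁| := by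
    refine (ContinuousLinearMap.opNorm_add_le _ _).trans (add_le_add
      ((norm_diagForm_le _ _).trans hp) ((norm_diagForm_le _ _).trans ?_))
    rw [norm_smul, norm_neg, Real.norm_eq_abs]
    exact mul_le_of_le_one_right (abs_nonneg _) hp
  have hD : fderiv ℝ (quadraticMap T) = T := fderiv_quadraticMap hTsymm
  have hD2 : fderiv ℝ (fderiv ℝ (quadraticMap T)) = fun _ => T := by
    rw [hD]; exact funext fun x => T.fderiv
  have hTx : ∀ x ∈ closedBall (0 : Euc n) 1, ‖T x‖ ≤ 1 + |A i₀ i₀ / A i₁ i₁| := fun x hx => by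
    rw [mem_closedBall_zero_iff] at hx
    exact (T.le_opNorm_of_le hx).trans (by linarith)
  refine ⟨quadraticMap T, ⟨contDiff_quadraticMap T, fun x hx => ?_, fun x hx => ?_, ?_⟩, ?_, ?_, ?_,
    fun y => ?_⟩
  · have h1 := hTx x hx
    have h2 : ‖T x x‖ ≤ 1 + |A i₀ i₀ / A i₁ i₁| := by
      rw [mem_closedBall_zero_iff] at hx
      exact ((T x).le_opNorm_of_le hx).trans (by linarith)
    rw [quadraticMap, norm_smul, Real.norm_of_nonneg (by norm_num)]
    linarith [norm_nonneg (T x x)]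
  · rw [hD]; exact hTx x hx
  · rw [hD2]; exact HolderBounded.const hTn
  · simp [quadraticMap]
  · rw [hD, map_zero]
  · rw [hD2]
    simp [hT, diagForm_apply, hi.symm]
  · rw [hD2]
    simp only [hT, map_add, matrixContraction_diagForm, smul_smul]
    rw [← add_smul]
    convert zero_smul ℝ p using 2
    field_simp; ring

variable {c₀ : Euc m} {c₁ : Euc n →L[ℝ] Euc m}

/-- Solvability of the rescaled system on the unit ball, with a prescribed pure second derivative
at the origin. -/
theorem exists_rescaled_solution {i₀ i₁ : Fin n} (hi : i₀ ≠ i₁)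
    {a : Fin n → Fin n → Jet n m → ℝ} {φ : Jet n m → Euc m} {r L lam ρ₀ : ℝ} (hα : 0 < α)
    (hα1 : α < 1) (hr : 0 < r) (hρ₀ : 0 < ρ₀)
    (ha : ∀ i j, C1HolderBounded α (closedBall (0, c₀, c₁) r) L (a i j))
    (hφ : C1HolderBounded α (closedBall (0, c₀, c₁) r) L φ) (hlam : 0 < lam)
    (hell : ∀ ξ : Euc n, lam * ‖ξ‖ ^ 2 ≤ ∑ i, ∑ j, a i j (0, c₀, c₁) * ξ i * ξ j) :
    ∃ ρ M : ℝ, 0 < ρ ∧ ρ ≤ 1 ∧ ρ ≤ ρ₀ ∧ ρ * (1 + ‖c₁‖ + M) ≤ r ∧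
      ∀ p : Euc m, ‖p‖ ≤ 1 → ∃ w : Euc n → Euc m, C2HolderBounded α M w ∧
        w 0 = 0 ∧ fderiv ℝ w 0 = 0 ∧
        fderiv ℝ (fderiv ℝ w) 0 (EuclideanSpace.single i₀ 1) (EuclideanSpace.single i₀ 1) = p ∧
        ∀ y ∈ closedBall (0 : Euc n) 1,
          ∑ i, ∑ j, a i j (rescaledJet c₀ c₁ ρ w y) •
            fderiv ℝ (fderiv ℝ w) y (EuclideanSpace.single i 1) (EuclideanSpace.single j 1)
          = φ (rescaledJet c₀ c₁ ρ w y) := by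
  set A : Fin n → Fin n → ℝ := fun i j => a i j (0, c₀, c₁) with hA
  obtain ⟨C, P, hC, hPlin, hP⟩ := exists_normalized_right_inverse (F := Euc m) hi A hlam hell hα hα1
    (δ := 1 / 8) (by norm_num)
  obtain ⟨H, hH, hquad⟩ := exists_quadratic_kernel (m := m) (α := α) hi
    (diag_pos_of_elliptic A hlam hell i₁).ne'
  -- Radius of the ball of densities `f`. With error constant `1 / 8`, `ρ B ≤ 1` and the factor `2`
  -- of the retraction, the iteration map has bound `2 (N / 8 + 1 + ‖φ(0, c₀, c₁)‖) = N / 2`.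
  set N : ℝ := 8 * (‖φ (0, c₀, c₁)‖ + 1) with hN
  have hN0 : 0 ≤ N := by positivity
  have hM : 0 ≤ C * N + H := by positivity
  obtain ⟨B, hB, hpert⟩ := exists_perturbation_bound hα hα1 hr ha hφ hM
  set M := C * N + H with hMdef
  have hc : 0 < 1 + ‖c₁‖ + M := by positivity
  -- The bounds keep the jets in the ball of radius `r`, and give `ρ B ≤ 1` for the self-map and `ρ
  -- B C ≤ 1 / 8` for the contraction, whose factor is `2 (1 / 8 + 1 / 8) = 1 / 2`.
  set ρ := min (min 1 ρ₀) (min (r / (1 + ‖c₁‖ + M)) (min (1 / (B + 1)) (1 / (8 * (B * C + 1)))))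
    with hρdef
  have hρ : 0 < ρ := by positivity
  have hρ1 : ρ ≤ 1 := (min_le_left _ _).trans (min_le_left _ _)
  have hρρ₀ : ρ ≤ ρ₀ := (min_le_left _ _).trans (min_le_right _ _)
  have hρr : ρ * (1 + ‖c₁‖ + M) ≤ r :=
    (le_div_iff₀ hc).1 ((min_le_right _ _).trans (min_le_left _ _))
  have hρB : ρ * B ≤ 1 := by
    have h : ρ ≤ 1 / (B + 1) :=
      ((min_le_right _ _).trans (min_le_right _ _)).trans (min_le_left _ _)
    rw [le_div_iff₀ (by positivity)] at h
    linarith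
  have hρBC : ρ * B * C ≤ 1 / 8 := by
    have h : ρ ≤ 1 / (8 * (B * C + 1)) :=
      ((min_le_right _ _).trans (min_le_right _ _)).trans (min_le_right _ _)
    rw [le_div_iff₀ (by positivity)] at h
    linarith
  obtain ⟨hpert1, hpert2⟩ := hpert ρ hρ.le hρ1 hρr
  refine ⟨ρ, M, hρ, hρ1, hρρ₀, hρr, fun p hp => ?_⟩
  obtain ⟨h, hh, hh0, hh1, hh2, hhA⟩ := hquad p hp
  have hPb : ∀ f K, HolderBounded α univ K f → C2HolderBounded α (C * K) (P f) := fun f K hf =>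
    have hf' := hP f K hf
    ⟨hf'.1, hf'.2.2.2.2.1, hf'.2.2.2.2.2.1, hf'.2.2.2.2.2.2.1.mono le_rfl (subset_univ _)⟩
  have hw : ∀ f, HolderBounded α univ N f → C2HolderBounded α M fun y => P f y + h y :=
    fun f hf => (hPb f N hf).add hh
  -- On the unit ball `S f = f` says that `A : D²(P f)` equals the perturbation at `P f + h`; since
  -- `A : D²h = 0`, this is the rescaled system for `w = P f + h`.
  let S (f : Euc n → Euc m) (y : Euc n) : Euc m :=
    (f y - matrixContraction A (fderiv ℝ (fderiv ℝ (P f)) y))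
      + perturbation a φ c₀ c₁ ρ (fun y => P f y + h y) y
  have hself : ∀ f, HolderBounded α univ N f →
      HolderBounded α univ N fun y => S f (unitRetraction y) := by
    intro f hf
    have hwf := hw f hf
    have h1 := ((hP f N hf).2.2.2.2.2.2.2.add (hpert1 _ hwf)).add
      (HolderBounded.const (c := φ (0, c₀, c₁)) (E := Euc n) le_rfl)
    refine ((h1.congr (g := S f) fun y _ => ?_).comp_unitRetraction hα hα1).mono ?_ subset_rfl
    · simp only [S]; abel
    · rw [hN]; linarith [norm_nonneg (φ (0, c₀, c₁))]
  have hcontr : ∀ f g δ, HolderBounded α univ N f → HolderBounded α univ N g →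
      HolderBounded α univ δ (fun x => f x - g x) →
      HolderBounded α univ (δ / 2) fun y => S f (unitRetraction y) - S g (unitRetraction y) := by
    intro f g δ hf hg hfg
    have hwf := hw f hf
    have hwg := hw g hg
    have hδ : 0 ≤ δ := hfg.nonneg (mem_univ 0)
    have hlin := hPlin f g N N hf hg
    have e : (fun x => (P f x + h x) - (P g x + h x)) = P fun x => f x - g x := by
      rw [hlin]; exact funext fun x => by abel
    have hd : C2HolderBounded α (C * δ) fun x => (P f x + h x) - (P g x + h x) := by
      rw [e]; exact hPb _ _ hfg
    have h1 := (hP _ δ hfg).2.2.2.2.2.2.2.add (hpert2 _ _ _ hwf hwg hd)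
    refine ((h1.congr (g := fun y => S f y - S g y) fun y _ => ?_).comp_unitRetraction hα hα1).mono
      ?_ subset_rfl
    · rw [hlin, (fderiv_fderiv_sub (hP f N hf).1 (hP g N hg).1).2]
      simp only [S, map_sub]; abel
    · have := mul_le_mul_of_nonneg_right hρBC hδ
      linarith
  obtain ⟨f, hf, hfix⟩ := exists_fixedPoint_of_holderBounded (α := α) hN0
    (fun f y => S f (unitRetraction y)) hself hcontr
  have hwf := hw f hf
  obtain ⟨hc2, hP0, hP1, hP2, -⟩ := hP f N hf
  obtain ⟨e1, e2⟩ := fderiv_fderiv_add hc2 hh.contDiff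
  refine ⟨fun y => P f y + h y, hwf, by simp only [hP0, hh0, add_zero],
    by simp only [e1, hP1, hh1, add_zero], ?_, fun y hy => ?_⟩
  · rw [e2]
    simp only [add_apply]
    rw [hP2, hh2, zero_add]
  · have h1 := congrFun hfix y
    simp only [unitRetraction_of_mem hy, S] at h1
    have h2 : matrixContraction A (fderiv ℝ (fderiv ℝ fun y => P f y + h y) y)
        = matrixContraction A (fderiv ℝ (fderiv ℝ (P f)) y) := by
      rw [e2]
      simp only [map_add, hhA, add_zero]
    rw [← h2, matrixContraction_apply, perturbation] at h1
    simp only [sub_smul, Finset.sum_sub_distrib, hA] at h1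
    rw [← sub_eq_zero] at h1 ⊢
    rw [← neg_eq_zero, ← h1]
    abel

end UnitScale

/-! ### Returning to the original scale -/

section Regularity

theorem C1HolderBounded.mono_const {V W : Type*} [NormedAddCommGroup V] [NormedSpace ℝ V]
    [NormedAddCommGroup W] [NormedSpace ℝ W] {α M N : ℝ} {K : Set V} {f : V → W}
    (hf : C1HolderBounded α K M f) (hMN : M ≤ N) : C1HolderBounded α K N f :=
  ⟨hf.1, hf.2.mono hMN subset_rfl⟩

/-- Inside the interior of `s` the derivative within `s` is the ordinary derivative, and compactness
of `K` supplies the sup bound. -/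
theorem IsC1HolderLoc.exists_c1HolderBounded {V W : Type*} [NormedAddCommGroup V] [NormedSpace ℝ V]
    [NormedAddCommGroup W] [NormedSpace ℝ W] {α : ℝ≥0} {s K : Set V} {f : V → W}
    (hf : IsC1HolderLoc α s f) (hK : IsCompact K) (hKs : K ⊆ interior s) :
    ∃ L, C1HolderBounded (α : ℝ) K L f := by
  obtain ⟨C, hC⟩ := hf.2 K (hKs.trans interior_subset) hK
  have hfd : ∀ z ∈ K, fderivWithin ℝ f s z = fderiv ℝ f z := fun z hz =>
    fderivWithin_of_mem_nhds (mem_interior_iff_mem_nhds.1 (hKs hz))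
  have hcont : ContinuousOn (fderiv ℝ f) K :=
    ((hf.1.mono interior_subset).continuousOn_fderiv_of_isOpen isOpen_interior le_rfl).mono hKs
  obtain ⟨B, hB⟩ := hK.exists_bound_of_continuousOn hcont
  refine ⟨max B C, fun z hz => ?_, fun z hz => (hB z hz).trans (le_max_left _ _),
    fun x hx y hy => ?_⟩
  · exact (hf.1.contDiffAt (mem_interior_iff_mem_nhds.1 (hKs hz))).differentiableAt one_ne_zero
  · have h := hC.dist_le hx hy
    rw [hfd x hx, hfd y hy, dist_eq_norm, dist_eq_norm] at h
    refine h.trans ?_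
    gcongr
    exact le_max_right _ _

theorem holderOnWith_of_norm_sub_le {X Y : Type*} [NormedAddCommGroup X] [NormedAddCommGroup Y]
    {C α : ℝ≥0} {s : Set X} {f : X → Y}
    (h : ∀ x ∈ s, ∀ y ∈ s, ‖f x - f y‖ ≤ C * ‖x - y‖ ^ (α : ℝ)) : HolderOnWith C α f s := by
  intro x hx y hy
  rw [edist_dist, edist_dist, ENNReal.ofReal_rpow_of_nonneg dist_nonneg α.coe_nonneg,
    ← ENNReal.ofReal_coe_nnreal (p := C), ← ENNReal.ofReal_mul C.coe_nonneg]
  apply ENNReal.ofReal_le_ofReal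
  rw [dist_eq_norm, dist_eq_norm]
  exact h x hx y hy

theorem hasFDerivAt_clm_apply_const {X Y Z : Type*} [NormedAddCommGroup X] [NormedSpace ℝ X]
    [NormedAddCommGroup Y] [NormedSpace ℝ Y] [NormedAddCommGroup Z] [NormedSpace ℝ Z]
    {c : X → Y →L[ℝ] Z} {c' : X →L[ℝ] Y →L[ℝ] Z} {x : X} (hc : HasFDerivAt c c' x) (v : Y) :
    HasFDerivAt (fun y => c y v) (c'.flip v) x := by
  simpa using hc.clm_apply (hasFDerivAt_const v x)

variable {n m : ℕ} {u : Euc n → Euc m} {R : ℝ}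

theorem uniqueDiffOn_euc_closedBall (hR : 0 < R) : UniqueDiffOn ℝ (closedBall (0 : Euc n) R) :=
  uniqueDiffOn_convex (convex_closedBall _ _)
    ⟨0, ball_subset_interior_closedBall (mem_ball_self hR)⟩

theorem fderivWithin_closedBall {G : Type*} [NormedAddCommGroup G] [NormedSpace ℝ G]
    {v : Euc n → G} (hR : 0 < R) (hv : Differentiable ℝ v) {x : Euc n}
    (hx : x ∈ closedBall (0 : Euc n) R) :
    fderivWithin ℝ v (closedBall 0 R) x = fderiv ℝ v x :=
  (hv x).fderivWithin (uniqueDiffOn_euc_closedBall hR x hx)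

/-- As `u` is `C²` on the whole space and the ball has unique derivatives even at its boundary,
derivatives within the ball are ordinary ones. -/
theorem partialD2_closedBall (hu : ContDiff ℝ 2 u) (hR : 0 < R) (k : Fin m) (i j : Fin n)
    {x : Euc n} (hx : x ∈ closedBall (0 : Euc n) R) :
    partialD2 (closedBall 0 R) i j (fun y => u y k) x
      = fderiv ℝ (fderiv ℝ u) x (EuclideanSpace.single i 1) (EuclideanSpace.single j 1) k := by
  have hd1 := hu.differentiable two_ne_zero
  have hd2 : Differentiable ℝ (fderiv ℝ u) :=
    (hu.fderiv_right (m := 1) (by norm_num)).differentiable one_ne_zero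
  have h1 : ∀ y, HasFDerivAt (fun y => u y k)
      ((EuclideanSpace.proj (𝕜 := ℝ) k).comp (fderiv ℝ u y)) y := fun y =>
    (EuclideanSpace.proj (𝕜 := ℝ) k).hasFDerivAt.comp y (hd1 y).hasFDerivAt
  have h2 : ∀ y ∈ closedBall (0 : Euc n) R, partialD (closedBall 0 R) j (fun y => u y k) y
      = fderiv ℝ u y (EuclideanSpace.single j 1) k := by
    intro y hy
    rw [partialD, fderivWithin_closedBall hR (fun y => (h1 y).differentiableAt) hy, (h1 y).fderiv]
    rfl
  have h3 : ∀ y, HasFDerivAt (fun y => fderiv ℝ u y (EuclideanSpace.single j 1) k)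
      ((EuclideanSpace.proj (𝕜 := ℝ) k).comp
        ((fderiv ℝ (fderiv ℝ u) y).flip (EuclideanSpace.single j 1))) y := fun y =>
    (EuclideanSpace.proj (𝕜 := ℝ) k).hasFDerivAt.comp y
      (hasFDerivAt_clm_apply_const (hd2 y).hasFDerivAt _)
  rw [partialD2, partialD, fderivWithin_congr h2 (h2 x hx),
    fderivWithin_closedBall hR (fun y => (h3 y).differentiableAt) hx, (h3 x).fderiv]
  rfl

variable {c₀ : Euc m} {c₁ : Euc n →L[ℝ] Euc m} {ρ : ℝ} {w : Euc n → Euc m}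

/-- The map whose 1-jets are given by `rescaledJet`. -/
noncomputable def rescaledMap (c₀ : Euc m) (c₁ : Euc n →L[ℝ] Euc m) (ρ : ℝ) (w : Euc n → Euc m)
    (x : Euc n) : Euc m :=
  c₀ + c₁ x + ρ ^ 2 • w (ρ⁻¹ • x)

theorem contDiff_rescaledMap (hw : ContDiff ℝ 2 w) : ContDiff ℝ 2 (rescaledMap c₀ c₁ ρ w) :=
  (contDiff_const.add c₁.contDiff).add
    ((hw.comp (contDiff_const_smul ρ⁻¹)).const_smul (ρ ^ 2))

theorem hasFDerivAt_comp_inv_smul {G : Type*} [NormedAddCommGroup G] [NormedSpace ℝ G]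
    {v : Euc n → G} (hv : Differentiable ℝ v) (x : Euc n) :
    HasFDerivAt (fun x => v (ρ⁻¹ • x)) (ρ⁻¹ • fderiv ℝ v (ρ⁻¹ • x)) x := by
  have h := ((hv _).hasFDerivAt (x := ρ⁻¹ • x)).comp x ((hasFDerivAt_id x).const_smul ρ⁻¹)
  rw [ContinuousLinearMap.comp_smul, ContinuousLinearMap.comp_id] at h
  exact h

theorem fderiv_rescaledMap (hρ : ρ ≠ 0) (hw : ContDiff ℝ 2 w) :
    fderiv ℝ (rescaledMap c₀ c₁ ρ w) = fun x => c₁ + ρ • fderiv ℝ w (ρ⁻¹ • x) := by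
  funext x
  have h := (c₁.hasFDerivAt (x := x)).const_add c₀ |>.add
    ((hasFDerivAt_comp_inv_smul (ρ := ρ) (hw.differentiable two_ne_zero) x).const_smul (ρ ^ 2))
  refine h.fderiv.trans ?_
  rw [smul_smul, pow_two, mul_assoc, mul_inv_cancel₀ hρ, mul_one]

theorem fderiv_fderiv_rescaledMap (hρ : ρ ≠ 0) (hw : ContDiff ℝ 2 w) (x : Euc n) :
    fderiv ℝ (fderiv ℝ (rescaledMap c₀ c₁ ρ w)) x = fderiv ℝ (fderiv ℝ w) (ρ⁻¹ • x) := by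
  rw [fderiv_rescaledMap hρ hw]
  have h := ((hasFDerivAt_comp_inv_smul (ρ := ρ)
    ((hw.fderiv_right (m := 1) (by norm_num)).differentiable one_ne_zero) x).const_smul ρ).const_add
      c₁
  refine h.fderiv.trans ?_
  rw [smul_smul, mul_inv_cancel₀ hρ, one_smul]

theorem jet_rescaledMap (hρ : ρ ≠ 0) (hw : ContDiff ℝ 2 w) (x : Euc n) :
    (x, rescaledMap c₀ c₁ ρ w x, fderiv ℝ (rescaledMap c₀ c₁ ρ w) x)
      = rescaledJet c₀ c₁ ρ w (ρ⁻¹ • x) := by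
  rw [fderiv_rescaledMap hρ hw]
  simp only [rescaledJet, rescaledMap, map_smul, smul_smul, mul_inv_cancel₀ hρ, one_smul]

/-- The same map serves every radius `R ≤ ρ`: `x ↦ ρ⁻¹ • x` sends the ball into the unit ball, jets
and Hessians correspond, and closeness of the jet to the base point keeps the values in the target
ball. -/
theorem isSolution_rescaledMap {α : ℝ≥0} {a : Fin n → Fin n → Jet n m → ℝ} {φ : Jet n m → Euc m}
    {M r R' : ℝ} (hρ : 0 < ρ) (hρ1 : ρ ≤ 1) (hρr : ρ * (1 + ‖c₁‖ + M) ≤ r) (hr : ‖c₀‖ + r ≤ R')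
    (hw : C2HolderBounded α M w) (hw0 : w 0 = 0) (hw1 : fderiv ℝ w 0 = 0)
    (heq : ∀ y ∈ closedBall (0 : Euc n) 1, ∑ i, ∑ j, a i j (rescaledJet c₀ c₁ ρ w y) •
      fderiv ℝ (fderiv ℝ w) y (EuclideanSpace.single i 1) (EuclideanSpace.single j 1)
        = φ (rescaledJet c₀ c₁ ρ w y)) (hR : 0 < R) (hRρ : R ≤ ρ) :
    IsSolution α a φ c₀ c₁ R R' (rescaledMap c₀ c₁ ρ w) := by
  have hu : ContDiff ℝ 2 (rescaledMap c₀ c₁ ρ w) := contDiff_rescaledMap hw.contDiff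
  have hmem : ∀ x ∈ closedBall (0 : Euc n) R, ρ⁻¹ • x ∈ closedBall (0 : Euc n) 1 := by
    intro x hx
    rw [mem_closedBall_zero_iff] at hx ⊢
    rw [norm_smul, norm_inv, Real.norm_of_nonneg hρ.le, inv_mul_le_iff₀ hρ]
    linarith
  have hfw : ∀ x ∈ closedBall (0 : Euc n) R,
      fderivWithin ℝ (rescaledMap c₀ c₁ ρ w) (closedBall 0 R) x
        = fderiv ℝ (rescaledMap c₀ c₁ ρ w) x :=
    fun x hx => fderivWithin_closedBall hR (hu.differentiable two_ne_zero) hx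
  refine ⟨fun x hx => ?_, ⟨hu.contDiffOn, fun k i j => ?_⟩, fun x hx => ?_, ?_, ?_⟩
  · have h1 := norm_rescaledJet_sub_le (c₀ := c₀) (c₁ := c₁) hρ.le hρ1 hw _ (hmem x hx)
    rw [← jet_rescaledMap hρ.ne' hw.contDiff] at h1
    have h2 := (norm_fst_le _).trans ((norm_snd_le _).trans h1)
    simp only [Prod.snd_sub, Prod.fst_sub] at h2
    rw [mem_closedBall_zero_iff]
    have := norm_sub_norm_le (rescaledMap c₀ c₁ ρ w x) c₀
    linarith
  · have hM := hw.nonneg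
    refine ⟨⟨M * ρ⁻¹ ^ (α : ℝ), by positivity⟩, holderOnWith_of_norm_sub_le fun x hx y hy => ?_⟩
    rw [partialD2_closedBall hu hR k i j hx, partialD2_closedBall hu hR k i j hy,
      fderiv_fderiv_rescaledMap hρ.ne' hw.contDiff, fderiv_fderiv_rescaledMap hρ.ne' hw.contDiff]
    have h := (hw.holder.apply_single i j).2 _ (hmem x hx) _ (hmem y hy)
    rw [← smul_sub, norm_smul, Real.norm_of_nonneg (inv_nonneg.2 hρ.le),
      Real.mul_rpow (inv_nonneg.2 hρ.le) (norm_nonneg _), ← mul_assoc] at h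
    exact (PiLp.norm_apply_le _ k).trans h
  · have h := heq _ (hmem x hx)
    rw [quasilinearOp, hfw x hx, jet_rescaledMap hρ.ne' hw.contDiff, ← h]
    ext k
    simp [partialD2_closedBall hu hR k _ _ hx, fderiv_fderiv_rescaledMap hρ.ne' hw.contDiff]
  · simp [rescaledMap, hw0]
  · rw [hfw 0 (mem_closedBall_self hR.le), fderiv_rescaledMap hρ.ne' hw.contDiff]
    beta_reduce
    rw [smul_zero, hw1]
    exact (congrArg (c₁ + ·) (smul_zero ρ)).trans (add_zero c₁)

end Regularity

/-! ### The main theorem -/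

theorem theorem1 (n m : ℕ) (hn : 2 ≤ n) (hm : 1 ≤ m)
    (α : ℝ≥0) (hα₀ : 0 < α) (hα₁ : α < 1)
    (a : Fin n → Fin n → Jet n m → ℝ)
    (ha : ∀ i j, IsC1HolderLoc α univ (a i j)) (hell : IsElliptic a)
    (R₀ R' : ℝ) (hR₀ : 0 < R₀) (φ : Jet n m → Euc m)
    (hφ : IsC1HolderLoc α (closedBall 0 R₀ ×ˢ closedBall 0 R' ×ˢ univ) φ)
    (c₀ : Euc m) (hc₀ : ‖c₀‖ < R') (c₁ : Euc n →L[ℝ] Euc m) :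
    ∃ R₁ : ℝ, 0 < R₁ ∧ R₁ ≤ R₀ ∧ ∀ R : ℝ, 0 < R → R ≤ R₁ →
      {v : closedBall (0 : Euc n) R → Euc m |
        ∃ u : Euc n → Euc m, IsSolution α a φ c₀ c₁ R R' u ∧
          (closedBall 0 R).domRestrict u = v}.Infinite := by
  obtain ⟨lam, hlam, hell⟩ := hell
  -- Strict inequalities put the ball of jets of radius `r` inside the interior of the domain of
  -- `φ`.
  obtain ⟨r, hr, hrR₀, hrR'⟩ : ∃ r, 0 < r ∧ r < R₀ ∧ ‖c₀‖ + r < R' := by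
    obtain ⟨r, hr, hr'⟩ := exists_between (lt_min hR₀ (sub_pos.2 hc₀))
    exact ⟨r, hr, hr'.trans_le (min_le_left _ _), by
      linarith [hr'.trans_le (min_le_right R₀ (R' - ‖c₀‖))]⟩
  have hK : IsCompact (closedBall ((0, c₀, c₁) : Jet n m) r) := isCompact_closedBall _ _
  have hKs : closedBall ((0, c₀, c₁) : Jet n m) r ⊆
      interior (closedBall 0 R₀ ×ˢ closedBall 0 R' ×ˢ univ) := by
    have ho : IsOpen (ball (0 : Euc n) R₀ ×ˢ ball (0 : Euc m) R' ×ˢ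
        (univ : Set (Euc n →L[ℝ] Euc m))) := isOpen_ball.prod (isOpen_ball.prod isOpen_univ)
    refine fun z hz => interior_maximal (Set.prod_mono ball_subset_closedBall
      (Set.prod_mono ball_subset_closedBall subset_rfl)) ho ?_
    rw [mem_closedBall, dist_eq_norm] at hz
    have h1 : ‖z.1 - 0‖ ≤ r := (norm_fst_le (z - (0, c₀, c₁))).trans hz
    have h2 : ‖z.2.1 - c₀‖ ≤ r :=
      (norm_fst_le (z - (0, c₀, c₁)).2).trans ((norm_snd_le (z - (0, c₀, c₁))).trans hz)
    refine ⟨?_, ?_, mem_univ _⟩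
    · rw [mem_ball_zero_iff]
      rw [sub_zero] at h1
      linarith
    · rw [mem_ball_zero_iff]
      linarith [norm_sub_norm_le z.2.1 c₀]
  obtain ⟨Lφ, hLφ⟩ := hφ.exists_c1HolderBounded hK hKs
  choose La hLa using fun i j => (ha i j).exists_c1HolderBounded hK (by simp)
  have hz : ((0, c₀, c₁) : Jet n m) ∈ closedBall (0, c₀, c₁) r := mem_closedBall_self hr.le
  have hLa0 : ∀ i j, 0 ≤ La i j := fun i j => (hLa i j).2.nonneg hz
  have hS : 0 ≤ ∑ i, ∑ j, La i j :=
    Finset.sum_nonneg fun i _ => Finset.sum_nonneg fun j _ => hLa0 i j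
  have hLaS : ∀ i j, La i j ≤ ∑ i, ∑ j, La i j := fun i j =>
    (Finset.single_le_sum (f := fun j => La i j) (fun j _ => hLa0 i j) (Finset.mem_univ j)).trans
      (Finset.single_le_sum (f := fun i => ∑ j, La i j)
        (fun i _ => Finset.sum_nonneg fun j _ => hLa0 i j) (Finset.mem_univ i))
  have hi : (⟨0, by omega⟩ : Fin n) ≠ ⟨1, by omega⟩ := by simp
  obtain ⟨ρ, M, hρ, hρ1, hρR₀, hρr, hsol⟩ := exists_rescaled_solution (c₀ := c₀) (c₁ := c₁)
    (L := Lφ + ∑ i, ∑ j, La i j) hi hα₀ hα₁ hr hR₀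
    (fun i j => (hLa i j).mono_const (by linarith [hLaS i j, hLφ.2.nonneg hz]))
    (hLφ.mono_const (by linarith)) hlam (hell (0, c₀, c₁))
  -- Pairwise distinct vectors of norm at most `1`, to be prescribed as second derivatives at the
  -- origin.
  let p (k : ℕ) : Euc m := EuclideanSpace.single ⟨0, hm⟩ (1 / ((k : ℝ) + 1))
  have hp : ∀ k, ‖p k‖ ≤ 1 := by
    intro k
    rw [PiLp.norm_single, Real.norm_of_nonneg (by positivity), div_le_one (by positivity)]
    linarith [(Nat.cast_nonneg k : (0 : ℝ) ≤ k)]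
  choose w hw hw0 hw1 hw2 heq using fun k => hsol (p k) (hp k)
  refine ⟨ρ, hρ, hρR₀, fun R hR hRρ => ?_⟩
  refine infinite_of_injective_forall_mem
    (f := fun k => (closedBall (0 : Euc n) R).domRestrict (rescaledMap c₀ c₁ ρ (w k)))
    (fun k l hkl => ?_) fun k => ⟨_, isSolution_rescaledMap hρ hρ1 hρr hrR'.le (hw k) (hw0 k)
      (hw1 k) (heq k) hR hRρ, rfl⟩
  -- Equal restrictions to the ball give equal germs at `0`, hence equal Hessians there, from which
  -- `p k = p l` is read off.
  have hloc : rescaledMap c₀ c₁ ρ (w k) =ᶠ[𝓝 0] rescaledMap c₀ c₁ ρ (w l) := by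
    filter_upwards [closedBall_mem_nhds (0 : Euc n) hR] with x hx
    exact congrFun hkl ⟨x, hx⟩
  have h2 := (hloc.fderiv (𝕜 := ℝ)).fderiv (𝕜 := ℝ) |>.eq_of_nhds
  rw [fderiv_fderiv_rescaledMap hρ.ne' (hw k).contDiff,
    fderiv_fderiv_rescaledMap hρ.ne' (hw l).contDiff, smul_zero] at h2
  have h3 : p k = p l := by rw [← hw2 k, ← hw2 l, h2]
  have h4 := congrArg (fun v : Euc m => v ⟨0, hm⟩) h3
  simpa [p] using h4
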